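/- Let $\Delta>0$. Let $\mathcal H_{\pi\Delta}$ be the set of entire functions $f:\mathbb C\to\mathbb C$ of exponential type at most $\pi\Delta$, that is, $\limsup_{|z|\to\infty}|z|^{-1}\log|f(z)|\le\pi\Delta$, such that $\int_{\mathbb R}|f(x)|^2\,dx<\infty$. For $G\in\{\mathrm{U},\mathrm{Sp},\mathrm{O},\mathrm{SO(even)},\mathrm{SO(odd)}\}$ let $W_G$ be the density $$W_{\mathrm U}(x)=1,\qquad W_{\mathrm{Sp}}(x)=1-\frac{\sin 2\pi x}{2\pi x},\qquad W_{\mathrm O}(x)=1+\tfrac12\,\boldsymbol\delta_0(x),$$ $$W_{\mathrm{SO(even)}}(x)=1+\frac{\sin 2\pi x}{2\pi x},\qquad W_{\mathrm{SO(odd)}}(x)=1-\frac{\sin 2\pi x}{2\pi x}+\boldsymbol\delta_0(x),$$ where $\boldsymbol\delta_0$ is the Dirac delta at $0$. For $\alpha\in\mathbb R$ put $$\mathbb A(G,\pi\Delta,\alpha):=\inf_{0\ne f\in\mathcal H_{\pi\Delta}}\frac{\int_{\mathbb R}|(x-\alpha)f(x)|^2\,W_G(x)\,dx}{\int_{\mathbb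 R}|f(x)|^2\,W_G(x)\,dx},$$ where the numerator may be $+\infty$. Then, for each of the five $G$, $$\lim_{|\alpha|\to\infty}\mathbb A(G,\pi\Delta,\alpha)=\mathbb A(\mathrm U,\pi\Delta,0)=\frac1{4\Delta^2}.$$ -/

import Mathlib

open MeasureTheory Filter Topology
open scoped ENNReal

/-- The five symmetry types of families of `L`-functions. -/
inductive SymmetryGroup : Type
  | U
  | Sp
  | O
  | SOeven
  | SOodd

/-- The measure `W_G(x) dx` on the real line, Dirac masses included. Here
`Real.sinc (2 * π * x)` is `sin (2 π x) / (2 π x)`, with value `1` at `x = 0`. -/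
noncomputable def densityMeasure : SymmetryGroup → Measure ℝ
  | .U => volume
  | .Sp => volume.withDensity (fun x => ENNReal.ofReal (1 - Real.sinc (2 * Real.pi * x)))
  | .O => volume + (1 / 2 : ℝ≥0∞) • Measure.dirac 0
  | .SOeven => volume.withDensity (fun x => ENNReal.ofReal (1 + Real.sinc (2 * Real.pi * x)))
  | .SOodd => volume.withDensity (fun x => ENNReal.ofReal (1 - Real.sinc (2 * Real.pi * x)))
      + Measure.dirac 0

/-- The exponential type `limsup_{|z| → ∞} |z|⁻¹ log |F z|`, computed in the extended reals,
with `log 0 = -∞`. -/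
noncomputable def exponentialType (F : ℂ → ℂ) : EReal :=
  limsup (fun z : ℂ => ((‖z‖⁻¹ : ℝ) : EReal) * ENNReal.log ‖F z‖ₑ) (Bornology.cobounded ℂ)

/-- The set of entire functions of exponential type at most `τ` whose restriction to the
real line is square integrable. -/
def paleyWienerSet (τ : ℝ) : Set (ℂ → ℂ) :=
  {f | Differentiable ℂ f ∧ exponentialType f ≤ (τ : EReal) ∧
    MemLp (fun x : ℝ => f (x : ℂ)) 2 volume}

/-- The extremal constant: the infimum over nonzero `f` of
`(∫ |(x - α) f(x)|² W_G(x) dx) / (∫ |f(x)|² W_G(x) dx)`. The integrals take values in `[0, ∞]`,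
so an `f` with infinite numerator (the denominator is always finite and positive) contributes
`∞` to the infimum. -/
noncomputable def extremalConstant (G : SymmetryGroup) (τ α : ℝ) : ℝ≥0∞ :=
  ⨅ f ∈ {f : ℂ → ℂ | f ∈ paleyWienerSet τ ∧ f ≠ 0},
    (∫⁻ x : ℝ, ‖((x : ℂ) - (α : ℂ)) * f (x : ℂ)‖ₑ ^ 2 ∂(densityMeasure G)) /
      (∫⁻ x : ℝ, ‖f (x : ℂ)‖ₑ ^ 2 ∂(densityMeasure G))

/-! Write τ for the type and a = π/(2τ). With τ = πΔ, the asserted limit is a².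

The unweighted inequality a² ∫|f|² ≤ ∫|x f|² rests on a band limit: the Fourier transform of |f|²
vanishes outside [-2τ, 2τ]. Hence, for L > τ, neither |f|² nor |x f|² sees any frequency 2kL with k
≠ 0, and integrating either one against sin(Lx)^(2N) only multiplies its integral by the mean m_N of
sin^(2N) (`integral_norm_sq_mul_sin_pow`). With a now equal to π/(2L), this gives m_N (∫|x f|² - a²
∫|f|²) = ∫ (x² - a²)|f|² sin(Lx)^(2N). The integrand is negative only for |x| < a, and there the
powers concentrate at ±a, where x² - a² vanishes. The negative part is therefore o(m_N) as N → ∞,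
and the inequality follows (`mul_integral_norm_sq_le`). Letting L decrease to τ removes the loss.
The band limit comes from shifting contours, controlled by the Plancherel–Pólya inequality.

Equality holds for cos(τx)/(x² - a²): multiplied by x² - a², its square becomes a difference of two
translates of one function of size O(1/|x|), and the integral telescopes to zero
(`integral_sq_mul_realExtremizer_sq`).

For the other symmetry types the density tends to 1 at infinity. Translating the extremizer by α
bounds the limit from above (`eventually_extremalConstant_lt`). For the lower bound, f is multiplied
by an entire cutoff of type 2ε, close to 1 near α and vanishing at the origin, so that the
unweighted inequality for the product yields a weighted one for f (`eventually_cutoff`,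
`ofReal_mul_weighted_lintegral_le`). A point mass at 0 is harmless, because it carries the ratio α²,
which is eventually large. -/

/-! ### Entire functions of exponential growth -/

/-- `u` is entire and `O(exp (σ |z|))`. -/
structure HasExpGrowth (σ : ℝ) (u : ℂ → ℂ) : Prop where
  differentiable : Differentiable ℂ u
  bound : ∃ C : ℝ, ∀ z, ‖u z‖ ≤ C * Real.exp (σ * ‖z‖)

namespace HasExpGrowth

variable {σ ρ : ℝ} {u v : ℂ → ℂ}

theorem bound_nonneg (hu : HasExpGrowth σ u) :
    ∃ C : ℝ, 0 ≤ C ∧ ∀ z, ‖u z‖ ≤ C * Real.exp (σ * ‖z‖) := by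
  obtain ⟨C, hC⟩ := hu.bound
  refine ⟨C, ?_, hC⟩
  have h := (norm_nonneg _).trans (hC 0)
  simpa using h

theorem mul (hu : HasExpGrowth σ u) (hv : HasExpGrowth ρ v) :
    HasExpGrowth (σ + ρ) (fun z => u z * v z) := by
  obtain ⟨C, hC0, hC⟩ := hu.bound_nonneg
  obtain ⟨D, hD0, hD⟩ := hv.bound_nonneg
  refine ⟨hu.differentiable.mul hv.differentiable, C * D, fun z => ?_⟩
  rw [norm_mul, add_mul, Real.exp_add]
  calc ‖u z‖ * ‖v z‖ ≤ (C * Real.exp (σ * ‖z‖)) * (D * Real.exp (ρ * ‖z‖)) := by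
        gcongr
        exacts [hC z, hD z]
    _ = _ := by ring

theorem add (hu : HasExpGrowth σ u) (hv : HasExpGrowth σ v) :
    HasExpGrowth σ (fun z => u z + v z) := by
  obtain ⟨C, hC0, hC⟩ := hu.bound_nonneg
  obtain ⟨D, hD0, hD⟩ := hv.bound_nonneg
  refine ⟨hu.differentiable.add hv.differentiable, C + D, fun z => ?_⟩
  rw [add_mul]
  exact (norm_add_le _ _).trans (add_le_add (hC z) (hD z))

theorem const (hσ : 0 ≤ σ) (c : ℂ) : HasExpGrowth σ (fun _ => c) := by
  refine ⟨by fun_prop, ‖c‖, fun z => ?_⟩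
  exact le_mul_of_one_le_right (norm_nonneg _) (Real.one_le_exp (by positivity))

theorem neg (hu : HasExpGrowth σ u) : HasExpGrowth σ (fun z => -u z) := by
  obtain ⟨C, hC⟩ := hu.bound
  exact ⟨hu.differentiable.neg, C, fun z => by simpa using hC z⟩

theorem comp_neg (hu : HasExpGrowth σ u) : HasExpGrowth σ (fun z => u (-z)) := by
  obtain ⟨C, hC⟩ := hu.bound
  exact ⟨hu.differentiable.comp differentiable_neg, C, fun z => by simpa using hC (-z)⟩

theorem comp_const_mul (hu : HasExpGrowth σ u) (c : ℝ) :
    HasExpGrowth (σ * |c|) (fun z => u (c * z)) := by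
  obtain ⟨C, hC⟩ := hu.bound
  refine ⟨hu.differentiable.comp (by fun_prop), C, fun z => (hC _).trans_eq ?_⟩
  simp [mul_assoc]

theorem comp_add_const (hu : HasExpGrowth σ u) (hσ : 0 ≤ σ) (c : ℂ) :
    HasExpGrowth σ (fun z => u (z + c)) := by
  obtain ⟨C, hC0, hC⟩ := hu.bound_nonneg
  refine ⟨hu.differentiable.comp (by fun_prop), C * Real.exp (σ * ‖c‖), fun z => ?_⟩
  refine (hC _).trans ?_
  rw [mul_assoc, ← Real.exp_add, ← mul_add]
  have := norm_add_le z c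
  gcongr
  linarith

theorem conj_conj (hu : HasExpGrowth σ u) :
    HasExpGrowth σ (fun z => (starRingEnd ℂ) (u ((starRingEnd ℂ) z))) := by
  obtain ⟨C, hC⟩ := hu.bound
  refine ⟨fun z => ?_, C, fun z => by simpa using hC ((starRingEnd ℂ) z)⟩
  have := (hu.differentiable ((starRingEnd ℂ) z)).conj_conj
  simpa [Function.comp_def] using this

theorem id_mul (hu : HasExpGrowth σ u) (h : σ < ρ) : HasExpGrowth ρ (fun z => z * u z) := by
  obtain ⟨C, hC0, hC⟩ := hu.bound_nonneg
  refine ⟨differentiable_id.mul hu.differentiable, C / (ρ - σ), fun z => ?_⟩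
  have hd : 0 < ρ - σ := sub_pos.2 h
  have h1 : (ρ - σ) * ‖z‖ ≤ Real.exp ((ρ - σ) * ‖z‖) := by
    have := Real.add_one_le_exp ((ρ - σ) * ‖z‖)
    linarith
  have h2 : ρ * ‖z‖ = (ρ - σ) * ‖z‖ + σ * ‖z‖ := by ring
  rw [norm_mul, h2, Real.exp_add, div_mul_eq_mul_div, le_div_iff₀ hd]
  calc ‖z‖ * ‖u z‖ * (ρ - σ) = ((ρ - σ) * ‖z‖) * ‖u z‖ := by ring
    _ ≤ Real.exp ((ρ - σ) * ‖z‖) * (C * Real.exp (σ * ‖z‖)) := by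
        gcongr
        exact hC z
    _ = _ := by ring

/-- Phragmén–Lindelöf in the upper half plane. -/
theorem norm_le_of_nonneg (hu : HasExpGrowth σ u) {A : ℝ} (hA : ∀ x : ℝ, ‖u x‖ ≤ A)
    {y : ℝ} (hy : 0 ≤ y) : ‖u (y * Complex.I)‖ ≤ A * Real.exp (σ * y) := by
  obtain ⟨C, hC0, hC⟩ := hu.bound_nonneg
  -- Rotating turns the upper half plane into the right one. The factor exp(-σw) has modulus 1 on
  -- the imaginary axis and cancels the growth of `u` along the positive ray.
  set g : ℂ → ℂ := fun w => u (Complex.I * w) * Complex.exp (-(σ * w)) with hg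
  have hgd : Differentiable ℂ g := by
    have := hu.differentiable
    fun_prop
  have hgn : ∀ w, ‖g w‖ = ‖u (Complex.I * w)‖ * Real.exp (-(σ * w.re)) := fun w => by
    simp [hg, Complex.norm_exp]
  have key := PhragmenLindelof.right_half_plane_of_bounded_on_real (f := g) (C := A) (z := (y : ℂ))
    hgd.diffContOnCl ?_ ?_ ?_ (by simpa using hy)
  · rw [hgn, mul_comm Complex.I] at key
    simp only [Complex.ofReal_re] at key
    rw [Real.exp_neg, ← div_eq_mul_inv, div_le_iff₀ (Real.exp_pos _)] at key
    exact key
  · refine ⟨1, by norm_num, |σ| + |σ|, Asymptotics.IsBigO.of_bound C (Eventually.of_forall ?_)⟩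
    intro w
    rw [hgn, Real.norm_eq_abs, abs_of_pos (Real.exp_pos _), Real.rpow_one, add_mul, Real.exp_add,
      ← mul_assoc]
    gcongr
    · refine (hC _).trans ?_
      have : σ * ‖Complex.I * w‖ ≤ |σ| * ‖w‖ := by
        rw [norm_mul, Complex.norm_I, one_mul]
        gcongr
        exact le_abs_self _
      gcongr
    · calc -(σ * w.re) ≤ |σ * w.re| := neg_le_abs _
        _ = |σ| * |w.re| := abs_mul _ _
        _ ≤ _ := by
          gcongr
          exact Complex.abs_re_le_norm w
  · refine ⟨C, ?_⟩
    rw [eventually_map]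
    filter_upwards [eventually_ge_atTop 0] with x hx
    rw [hgn]
    have h1 := hC (Complex.I * x)
    simp only [norm_mul, Complex.norm_I, one_mul, Complex.norm_real, Real.norm_eq_abs,
      abs_of_nonneg hx] at h1
    simp only [Complex.ofReal_re]
    rw [Real.exp_neg, ← div_eq_mul_inv, div_le_iff₀ (Real.exp_pos _)]
    exact h1
  · intro x
    rw [hgn]
    have : Complex.I * (x * Complex.I) = ((-x : ℝ) : ℂ) := by
      rw [mul_left_comm, Complex.I_mul_I]; push_cast; ring
    rw [this]
    simpa using hA (-x)

theorem norm_le_exp_abs (hu : HasExpGrowth σ u) {A : ℝ} (hA : ∀ x : ℝ, ‖u x‖ ≤ A) (y : ℝ) :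
    ‖u (y * Complex.I)‖ ≤ A * Real.exp (σ * |y|) := by
  rcases le_total 0 y with hy | hy
  · rw [abs_of_nonneg hy]
    exact hu.norm_le_of_nonneg hA hy
  · have := hu.comp_neg.norm_le_of_nonneg (A := A) (fun x => by simpa using hA (-x))
      (neg_nonneg.2 hy)
    rw [abs_of_nonpos hy]
    simpa using this

theorem continuous (hu : HasExpGrowth σ u) : Continuous u := hu.differentiable.continuous

/-- Keeps a truncated correlation of `u` with `k` within the reach of Phragmén–Lindelöf. The
interval is compact, so differentiation under the integral is legitimate and the type does not grow.
-/
theorem intervalIntegral_translate (hu : HasExpGrowth σ u) (hσ : 0 ≤ σ) {k : ℝ → ℂ}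
    (hk : Continuous k) (T : ℝ) :
    HasExpGrowth σ (fun z => ∫ t in (-T)..T, u (z + t) * k t) := by
  have hcu := hu.continuous
  have hcd : Continuous (deriv u) := hu.differentiable.contDiff.continuous_deriv (n := 1) le_rfl
  refine ⟨fun z₀ => ?_, ?_⟩
  · obtain ⟨M, hM⟩ := (isCompact_closedBall (0 : ℂ) (‖z₀‖ + 1 + |T|)).exists_bound_of_continuousOn
      hcd.continuousOn
    refine (intervalIntegral.hasDerivAt_integral_of_dominated_loc_of_deriv_le
      (F := fun z t => u (z + t) * k t) (F' := fun z t => deriv u (z + t) * k t)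
      (bound := fun t => M * ‖k t‖) (μ := volume) (x₀ := z₀) (Metric.ball_mem_nhds z₀ one_pos)
      (Eventually.of_forall fun z => ?_) ?_ ?_ ?_ ?_ ?_).2.differentiableAt
    · exact Continuous.aestronglyMeasurable (by fun_prop)
    · exact Continuous.intervalIntegrable (by fun_prop) _ _
    · exact Continuous.aestronglyMeasurable (by fun_prop)
    · refine Eventually.of_forall fun t ht z hz => ?_
      rw [norm_mul]
      gcongr
      apply hM
      rw [mem_closedBall_zero_iff]
      have h1 : ‖z‖ ≤ ‖z₀‖ + 1 := by
        have := norm_le_norm_add_norm_sub' z z₀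
        rw [Metric.mem_ball, dist_eq_norm] at hz
        linarith
      have h2 : ‖(t : ℂ)‖ ≤ |T| := by
        rw [Complex.norm_real, Real.norm_eq_abs]
        have := Set.uIoc_subset_uIcc ht
        rw [Set.mem_uIcc] at this
        rw [abs_le]
        rcases this with h | h
        · exact ⟨by linarith [le_abs_self T], by linarith [le_abs_self T]⟩
        · exact ⟨by linarith [neg_le_abs T], by linarith [neg_le_abs T]⟩
      exact (norm_add_le _ _).trans (add_le_add h1 h2)
    · exact Continuous.intervalIntegrable (by fun_prop) _ _
    · refine Eventually.of_forall fun t _ z _ => ?_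
      have := (hu.differentiable (z + t)).hasDerivAt.comp_add_const z (t : ℂ)
      exact this.mul_const (k t)
  · obtain ⟨C, hC0, hC⟩ := hu.bound_nonneg
    obtain ⟨M, hM⟩ := (isCompact_uIcc (a := -T) (b := T)).exists_bound_of_continuousOn
      hk.continuousOn
    refine ⟨C * Real.exp (σ * |T|) * M * |T - -T|, fun z => ?_⟩
    refine (intervalIntegral.norm_integral_le_of_norm_le_const
      (C := C * Real.exp (σ * ‖z‖) * Real.exp (σ * |T|) * M) fun t ht => ?_).trans_eq (by ring)
    have ht' := Set.uIoc_subset_uIcc ht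
    rw [norm_mul]
    have h2 : ‖(t : ℂ)‖ ≤ |T| := by
      rw [Complex.norm_real, Real.norm_eq_abs]
      rw [Set.mem_uIcc] at ht'
      rw [abs_le]
      rcases ht' with h | h
      · exact ⟨by linarith [le_abs_self T], by linarith [le_abs_self T]⟩
      · exact ⟨by linarith [neg_le_abs T], by linarith [neg_le_abs T]⟩
    gcongr
    · refine (hC _).trans ?_
      rw [mul_assoc, ← Real.exp_add, ← mul_add]
      have := norm_add_le z (t : ℂ)
      gcongr
      linarith
    · exact hM t ht'

end HasExpGrowth

/-! ### Contour shifts, Plancherel–Pólya and the band limit of |u|² -/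

/-- Shifting the line of integration of an entire function which is small on vertical segments. -/
theorem integral_eq_integral_add_mul_I {F : ℂ → ℂ} (hF : Differentiable ℂ F) {y : ℝ}
    (hy : 0 ≤ y) (h0 : Integrable fun x : ℝ => F x)
    (h1 : Integrable fun x : ℝ => F (x + y * Complex.I)) {ρ : ℝ → ℝ} (hρ : Tendsto ρ atTop (𝓝 0))
    (hside : ∀ T : ℝ, 0 ≤ T → ∀ s ∈ Set.Icc 0 y,
      ‖F (T + s * Complex.I)‖ ≤ ρ T ∧ ‖F ((-T : ℝ) + s * Complex.I)‖ ≤ ρ T) :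
    ∫ x : ℝ, F x = ∫ x : ℝ, F (x + y * Complex.I) := by
  have hrect : ∀ T : ℝ, (∫ x in (-T)..T, F x) - (∫ x in (-T)..T, F (x + y * Complex.I)) =
      -(Complex.I * ∫ s in (0 : ℝ)..y, F (T + s * Complex.I))
        + Complex.I * ∫ s in (0 : ℝ)..y, F ((-T : ℝ) + s * Complex.I) := by
    intro T
    have := Complex.integral_boundary_rect_eq_zero_of_differentiableOn F (-T : ℝ) (T + y * Complex.I)
      hF.differentiableOn
    simp only [Complex.ofReal_re, Complex.ofReal_im, Complex.add_re, Complex.add_im, Complex.mul_re,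
      Complex.mul_im, Complex.I_re, Complex.I_im, mul_zero, mul_one, zero_add, add_zero,
      Complex.ofReal_zero, zero_mul, smul_eq_mul, sub_self] at this
    linear_combination this
  have hbd : ∀ (w : ℝ → ℝ), (∀ T, 0 ≤ T → ∀ s ∈ Set.Icc 0 y, ‖F (w T + s * Complex.I)‖ ≤ ρ T) →
      Tendsto (fun T : ℝ => ∫ s in (0 : ℝ)..y, F (w T + s * Complex.I)) atTop (𝓝 0) := by
    intro w hw
    have hlim : Tendsto (fun T => ρ T * |y - 0|) atTop (𝓝 0) := by
      simpa using hρ.mul_const |y - 0|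
    refine squeeze_zero_norm' ?_ hlim
    filter_upwards [eventually_ge_atTop 0] with T hT
    refine intervalIntegral.norm_integral_le_of_norm_le_const fun s hs => ?_
    rw [Set.uIoc_of_le hy] at hs
    exact hw T hT s ⟨hs.1.le, hs.2⟩
  have hL := (intervalIntegral_tendsto_integral h0 tendsto_neg_atTop_atBot tendsto_id).sub
    (intervalIntegral_tendsto_integral h1 tendsto_neg_atTop_atBot tendsto_id)
  have hR := ((hbd (fun T => T) fun T hT s hs => (hside T hT s hs).1).const_mul Complex.I).neg.add
    ((hbd (fun T => -T) fun T hT s hs => (hside T hT s hs).2).const_mul Complex.I)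
  have := tendsto_nhds_unique (hL.congr hrect) hR
  simpa [sub_eq_zero] using this

namespace HasExpGrowth

variable {σ ρ : ℝ} {u v : ℂ → ℂ}

/-- A duality argument. Correlate `u` with the conjugate of its own restriction to height y, cut off
to [-T, T]. The resulting entire function equals κ at iy and is bounded on the real line, so
Phragmén–Lindelöf gives κ ≤ (E²A + κ)/2. The truncation makes κ finite, and κ/2 can be absorbed. -/
theorem intervalIntegral_norm_sq_le (hu : HasExpGrowth σ u) (hσ : 0 ≤ σ)
    (hi : Integrable fun x : ℝ => ‖u x‖ ^ 2) (y : ℝ) {T : ℝ} (hT : 0 ≤ T) :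
    ∫ t in (-T)..T, ‖u (t + y * Complex.I)‖ ^ 2 ≤
      Real.exp (2 * σ * |y|) * ∫ x : ℝ, ‖u x‖ ^ 2 := by
  have hcu := hu.continuous
  have hTT : -T ≤ T := by linarith
  set k : ℝ → ℂ := fun t => (starRingEnd ℂ) (u (t + y * Complex.I)) with hk
  have hkc : Continuous k := by
    have := Complex.continuous_conj
    fun_prop
  have hG := hu.intervalIntegral_translate hσ hkc T
  set κ : ℝ := ∫ t in (-T)..T, ‖u (t + y * Complex.I)‖ ^ 2 with hκ
  set A : ℝ := ∫ x : ℝ, ‖u x‖ ^ 2 with hA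
  set E : ℝ := Real.exp (σ * |y|) with hE
  have hE0 : 0 < E := Real.exp_pos _
  have hbound : ∀ x : ℝ, ‖∫ t in (-T)..T, u (x + t) * k t‖ ≤ (E * A + E⁻¹ * κ) / 2 := by
    intro x
    have h1 : ‖∫ t in (-T)..T, u (x + t) * k t‖ ≤
        ∫ t in (-T)..T, (E / 2 * ‖u (x + t)‖ ^ 2 + E⁻¹ / 2 * ‖u (t + y * Complex.I)‖ ^ 2) := by
      refine intervalIntegral.norm_integral_le_of_norm_le hTT
        (Eventually.of_forall fun t _ => ?_) (Continuous.intervalIntegrable (by fun_prop) _ _)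
      rw [norm_mul, hk, RCLike.norm_conj]
      set p := ‖u (x + t)‖
      set q := ‖u (t + y * Complex.I)‖
      -- The weights E and E⁻¹ are chosen so that the factor E lost in Phragmén–Lindelöf leaves κ
      -- with coefficient exactly 1/2.
      have hsq : E / 2 * p ^ 2 + E⁻¹ / 2 * q ^ 2 - p * q = E⁻¹ / 2 * (E * p - q) ^ 2 := by
        field_simp
        ring
      have : 0 ≤ E⁻¹ / 2 * (E * p - q) ^ 2 := by positivity
      linarith
    refine h1.trans ?_
    rw [intervalIntegral.integral_add (Continuous.intervalIntegrable (by fun_prop) _ _)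
      (Continuous.intervalIntegrable (by fun_prop) _ _), intervalIntegral.integral_const_mul,
      intervalIntegral.integral_const_mul]
    have h2 : ∫ t in (-T)..T, ‖u (x + t)‖ ^ 2 ≤ A := by
      have hi' : Integrable fun t : ℝ => ‖u ((x + t : ℝ) : ℂ)‖ ^ 2 := hi.comp_add_left x
      rw [hA, ← integral_add_left_eq_self (fun t : ℝ => ‖u t‖ ^ 2) x,
        intervalIntegral.integral_of_le hTT]
      simp only [Complex.ofReal_add] at hi' ⊢
      exact setIntegral_le_integral hi' (Eventually.of_forall fun t => by positivity)
    have h3 : E / 2 * ∫ t in (-T)..T, ‖u (x + t)‖ ^ 2 ≤ E / 2 * A := by gcongr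
    linarith
  have hmain := hG.norm_le_exp_abs hbound y
  have hval : (∫ t in (-T)..T, u (y * Complex.I + t) * k t) = (κ : ℂ) := by
    rw [hκ, ← intervalIntegral.integral_ofReal]
    refine intervalIntegral.integral_congr fun t _ => ?_
    simp only [hk]
    rw [add_comm, Complex.mul_conj, Complex.normSq_eq_norm_sq]
  have hκ0 : 0 ≤ κ := intervalIntegral.integral_nonneg hTT fun t _ => by positivity
  rw [hval, Complex.norm_real, Real.norm_eq_abs, abs_of_nonneg hκ0, ← hE] at hmain
  have hEE : Real.exp (2 * σ * |y|) = E ^ 2 := by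
    rw [hE, ← Real.exp_nat_mul]
    congr 1
    push_cast
    ring
  rw [hEE]
  have : (E * A + E⁻¹ * κ) / 2 * E = (E ^ 2 * A + κ) / 2 := by
    field_simp
  rw [this] at hmain
  linarith

/-- The Plancherel–Pólya inequality. -/
theorem integrable_and_integral_norm_sq_le (hu : HasExpGrowth σ u) (hσ : 0 ≤ σ)
    (hi : Integrable fun x : ℝ => ‖u x‖ ^ 2) (y : ℝ) :
    Integrable (fun x : ℝ => ‖u (x + y * Complex.I)‖ ^ 2) ∧
      ∫ x : ℝ, ‖u (x + y * Complex.I)‖ ^ 2 ≤ Real.exp (2 * σ * |y|) * ∫ x : ℝ, ‖u x‖ ^ 2 := by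
  have hcu := hu.continuous
  have hint : Integrable (fun x : ℝ => ‖u (x + y * Complex.I)‖ ^ 2) := by
    refine integrable_of_intervalIntegral_norm_bounded (l := atTop) (a := fun T : ℝ => -T)
      (b := fun T => T) (Real.exp (2 * σ * |y|) * ∫ x : ℝ, ‖u x‖ ^ 2) (fun T => ?_)
      tendsto_neg_atTop_atBot tendsto_id ?_
    · exact (Continuous.integrableOn_Icc (by fun_prop)).mono_set Set.Ioc_subset_Icc_self
    · filter_upwards [eventually_ge_atTop 0] with T hT
      simpa using hu.intervalIntegral_norm_sq_le hσ hi y hT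
  refine ⟨hint, ?_⟩
  refine le_of_tendsto (intervalIntegral_tendsto_integral hint tendsto_neg_atTop_atBot tendsto_id) ?_
  filter_upwards [eventually_ge_atTop 0] with T hT
  exact hu.intervalIntegral_norm_sq_le hσ hi y hT

/-- The entire function equal to `|u|²` on the real line. -/
noncomputable def normSqExt (u : ℂ → ℂ) (z : ℂ) : ℂ :=
  u z * (starRingEnd ℂ) (u ((starRingEnd ℂ) z))

theorem normSqExt_ofReal (u : ℂ → ℂ) (x : ℝ) : normSqExt u x = ((‖u x‖ ^ 2 : ℝ) : ℂ) := by
  rw [normSqExt, Complex.conj_ofReal, Complex.mul_conj, Complex.normSq_eq_norm_sq]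

theorem integrable_and_integral_norm_normSqExt_le (hu : HasExpGrowth σ u) (hσ : 0 ≤ σ)
    (hi : Integrable fun x : ℝ => ‖u x‖ ^ 2) (y : ℝ) :
    Integrable (fun x : ℝ => ‖normSqExt u (x + y * Complex.I)‖) ∧
      ∫ x : ℝ, ‖normSqExt u (x + y * Complex.I)‖ ≤
        Real.exp (2 * σ * |y|) * ∫ x : ℝ, ‖u x‖ ^ 2 := by
  have hcu := hu.continuous
  have hcG : Continuous (normSqExt u) :=
    (hu.mul hu.conj_conj).continuous
  obtain ⟨h1, h1'⟩ := hu.integrable_and_integral_norm_sq_le hσ hi y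
  obtain ⟨h2, h2'⟩ := hu.integrable_and_integral_norm_sq_le hσ hi (-y)
  rw [abs_neg] at h2'
  have hle : ∀ x : ℝ, ‖normSqExt u (x + y * Complex.I)‖ ≤
      (‖u (x + y * Complex.I)‖ ^ 2 + ‖u (x + (-y : ℝ) * Complex.I)‖ ^ 2) / 2 := by
    intro x
    have hc : (starRingEnd ℂ) (x + y * Complex.I) = x + (-y : ℝ) * Complex.I := by
      simp
    rw [normSqExt, norm_mul, RCLike.norm_conj, hc]
    nlinarith [sq_nonneg (‖u (x + y * Complex.I)‖ - ‖u (x + (-y : ℝ) * Complex.I)‖)]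
  have hsum := (h1.add h2).div_const 2
  have hint : Integrable (fun x : ℝ => ‖normSqExt u (x + y * Complex.I)‖) := by
    refine hsum.mono' (Continuous.aestronglyMeasurable (by fun_prop))
      (Eventually.of_forall fun x => ?_)
    rw [norm_norm]
    exact hle x
  refine ⟨hint, (integral_mono hint hsum hle).trans ?_⟩
  simp only [Pi.add_apply]
  rw [integral_div, integral_add h1 h2]
  linarith

/-- The contour is moved up to height y, where exp(iλz) has modulus exp(-λy). On vertical sides the
extension of |u|² is only known to be O(exp(2σ|z|)); the Gaussian makes these sides vanish, at the
price of a factor exp(εy²) on the shifted line. -/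
theorem norm_integral_norm_sq_mul_cexp_le (hu : HasExpGrowth σ u) (hσ : 0 ≤ σ)
    (hi : Integrable fun x : ℝ => ‖u x‖ ^ 2) {lam : ℝ} (hl : 0 ≤ lam) {y : ℝ} (hy : 0 ≤ y)
    {ε : ℝ} (hε : 0 < ε) :
    ‖∫ x : ℝ, ((‖u x‖ ^ 2 : ℝ) : ℂ) * Complex.exp (Complex.I * lam * x) * Complex.exp (-ε * x ^ 2)‖ ≤
      Real.exp (-(lam * y) + ε * y ^ 2) * (Real.exp (2 * σ * y) * ∫ x : ℝ, ‖u x‖ ^ 2) := by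
  have hcu := hu.continuous
  have hGg : HasExpGrowth (σ + σ) (normSqExt u) := hu.mul hu.conj_conj
  have hcG : Continuous (normSqExt u) := hGg.continuous
  set F : ℂ → ℂ := fun z =>
    normSqExt u z * Complex.exp (Complex.I * lam * z) * Complex.exp (-ε * z ^ 2) with hF
  have hFd : Differentiable ℂ F := by
    have := hGg.differentiable
    fun_prop
  have hFc : Continuous F := hFd.continuous
  have hFn : ∀ x s : ℝ, ‖F (x + s * Complex.I)‖ = ‖normSqExt u (x + s * Complex.I)‖ *
      Real.exp (-(lam * s) + ε * s ^ 2 - ε * x ^ 2) := by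
    intro x s
    have e1 : (Complex.I * lam * (x + s * Complex.I)).re = -(lam * s) := by simp
    have e2 : (-ε * (x + s * Complex.I) ^ 2 : ℂ).re = ε * s ^ 2 - ε * x ^ 2 := by
      simp [sq]
      ring
    rw [hF]
    simp only [norm_mul, Complex.norm_exp]
    rw [e1, e2, mul_assoc, ← Real.exp_add, add_sub_assoc]
  have hFle : ∀ x s : ℝ, ‖F (x + s * Complex.I)‖ ≤
      Real.exp (-(lam * s) + ε * s ^ 2) * ‖normSqExt u (x + s * Complex.I)‖ := by
    intro x s
    rw [hFn, mul_comm]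
    gcongr
    have : 0 ≤ ε * x ^ 2 := by positivity
    linarith
  have hFint : ∀ s : ℝ, Integrable fun x : ℝ => F (x + s * Complex.I) := by
    intro s
    refine ((hu.integrable_and_integral_norm_normSqExt_le hσ hi s).1.const_mul
      (Real.exp (-(lam * s) + ε * s ^ 2))).mono' (Continuous.aestronglyMeasurable (by fun_prop))
      (Eventually.of_forall fun x => hFle x s)
  obtain ⟨C, hC0, hC⟩ := hGg.bound_nonneg
  have hside : ∀ x s : ℝ, s ∈ Set.Icc 0 y → ‖F (x + s * Complex.I)‖ ≤
      C * Real.exp ((σ + σ) * (|x| + y) + ε * y ^ 2 - ε * |x| ^ 2) := by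
    intro x s hs
    rw [hFn, sq_abs]
    have hn : ‖(x + s * Complex.I : ℂ)‖ ≤ |x| + y := by
      refine (norm_add_le _ _).trans ?_
      simp only [Complex.norm_real, norm_mul, Complex.norm_I, mul_one, Real.norm_eq_abs]
      rw [abs_of_nonneg hs.1]
      linarith [hs.2]
    have h1 : ‖normSqExt u (x + s * Complex.I)‖ ≤ C * Real.exp ((σ + σ) * (|x| + y)) := by
      refine (hC _).trans ?_
      gcongr
    have h2 : -(lam * s) + ε * s ^ 2 - ε * x ^ 2 ≤ ε * y ^ 2 - ε * x ^ 2 := by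
      have : ε * s ^ 2 ≤ ε * y ^ 2 := by
        have := hs.1
        have := hs.2
        gcongr
      have : 0 ≤ lam * s := mul_nonneg hl hs.1
      linarith
    calc _ ≤ (C * Real.exp ((σ + σ) * (|x| + y))) * Real.exp (ε * y ^ 2 - ε * x ^ 2) := by
          gcongr
      _ = _ := by rw [mul_assoc, ← Real.exp_add]; ring_nf
  have hρ : Tendsto (fun T : ℝ => C * Real.exp ((σ + σ) * (T + y) + ε * y ^ 2 - ε * T ^ 2)) atTop
      (𝓝 0) := by
    rw [← mul_zero C]
    refine Tendsto.const_mul _ (Real.tendsto_exp_atBot.comp ?_)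
    have h1 : Tendsto (fun T : ℝ => T * (ε * T - (σ + σ))) atTop atTop :=
      Tendsto.atTop_mul_atTop₀ tendsto_id
        (tendsto_atTop_add_const_right _ _ (tendsto_id.const_mul_atTop hε))
    have h2 := tendsto_atBot_add_const_right atTop ((σ + σ) * y + ε * y ^ 2)
      (tendsto_neg_atTop_atBot.comp h1)
    refine h2.congr fun T => ?_
    simp only [Function.comp_apply]
    ring
  have hshift := integral_eq_integral_add_mul_I hFd hy (by simpa using hFint 0) (hFint y) hρ
    (fun T hT s hs => by
      refine ⟨?_, ?_⟩
      · simpa [abs_of_nonneg hT] using hside T s hs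
      · simpa only [abs_neg, abs_of_nonneg hT] using hside (-T) s hs)
  have hFr : ∀ x : ℝ, F x = ((‖u x‖ ^ 2 : ℝ) : ℂ) * Complex.exp (Complex.I * lam * x) *
      Complex.exp (-ε * x ^ 2) := fun x => by
    rw [hF]
    simp only [normSqExt_ofReal]
  simp only [← hFr]
  rw [hshift]
  obtain ⟨hi1, hi2⟩ := hu.integrable_and_integral_norm_normSqExt_le hσ hi y
  rw [abs_of_nonneg hy] at hi2
  refine (norm_integral_le_integral_norm _).trans ?_
  refine (integral_mono (hFint y).norm (hi1.const_mul _) fun x => hFle x y).trans ?_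
  rw [integral_const_mul]
  gcongr

/-- First ε → 0 at fixed height y, then y → ∞: the surviving factor exp(-(λ - 2σ)y) tends to 0. -/
theorem integral_norm_sq_mul_cexp_eq_zero_of_lt (hu : HasExpGrowth σ u) (hσ : 0 ≤ σ)
    (hi : Integrable fun x : ℝ => ‖u x‖ ^ 2) {lam : ℝ} (hl : 2 * σ < lam) :
    ∫ x : ℝ, ((‖u x‖ ^ 2 : ℝ) : ℂ) * Complex.exp (Complex.I * lam * x) = 0 := by
  have hcu := hu.continuous
  have hl0 : 0 ≤ lam := by linarith
  have hlim : Tendsto (fun ε : ℝ => ∫ x : ℝ, ((‖u x‖ ^ 2 : ℝ) : ℂ) *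
      Complex.exp (Complex.I * lam * x) * Complex.exp (-ε * x ^ 2)) (𝓝[>] 0)
      (𝓝 (∫ x : ℝ, ((‖u x‖ ^ 2 : ℝ) : ℂ) * Complex.exp (Complex.I * lam * x))) := by
    refine tendsto_integral_filter_of_dominated_convergence (fun x => ‖u x‖ ^ 2)
      (Eventually.of_forall fun ε => Continuous.aestronglyMeasurable (by fun_prop)) ?_ hi ?_
    · filter_upwards [self_mem_nhdsWithin] with ε hε
      refine Eventually.of_forall fun x => ?_
      have e1 : (Complex.I * lam * x : ℂ).re = 0 := by simp
      have e2 : (-ε * x ^ 2 : ℂ).re = -(ε * x ^ 2) := by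
        rw [← Complex.ofReal_pow, ← Complex.ofReal_neg, ← Complex.ofReal_mul, Complex.ofReal_re]
        ring
      rw [norm_mul, norm_mul, Complex.norm_exp, Complex.norm_exp, e1, e2, Real.exp_zero, mul_one,
        Complex.norm_real, Real.norm_eq_abs, abs_of_nonneg (by positivity)]
      refine mul_le_of_le_one_right (by positivity) ?_
      rw [Real.exp_le_one_iff]
      have : 0 ≤ ε * x ^ 2 := mul_nonneg (le_of_lt hε) (sq_nonneg x)
      linarith
    · refine Eventually.of_forall fun x => ?_
      have hc : Continuous fun ε : ℝ => ((‖u x‖ ^ 2 : ℝ) : ℂ) *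
          Complex.exp (Complex.I * lam * x) * Complex.exp (-ε * x ^ 2) := by fun_prop
      have := (hc.tendsto 0).mono_left (nhdsWithin_le_nhds (s := Set.Ioi 0))
      simpa using this
  have hb : ∀ y : ℝ, 0 ≤ y →
      ‖∫ x : ℝ, ((‖u x‖ ^ 2 : ℝ) : ℂ) * Complex.exp (Complex.I * lam * x)‖ ≤
      Real.exp (-((lam - 2 * σ) * y)) * ∫ x : ℝ, ‖u x‖ ^ 2 := by
    intro y hy
    have hc : Continuous fun ε : ℝ => Real.exp (-(lam * y) + ε * y ^ 2) *
        (Real.exp (2 * σ * y) * ∫ x : ℝ, ‖u x‖ ^ 2) := by fun_prop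
    have h1 := (hc.tendsto 0).mono_left (nhdsWithin_le_nhds (s := Set.Ioi 0))
    have h2 := le_of_tendsto_of_tendsto hlim.norm h1 (by
      filter_upwards [self_mem_nhdsWithin] with ε hε
      exact hu.norm_integral_norm_sq_mul_cexp_le hσ hi hl0 hy hε)
    refine h2.trans_eq ?_
    rw [← mul_assoc, ← Real.exp_add]
    ring_nf
  have hlim2 : Tendsto (fun y : ℝ => Real.exp (-((lam - 2 * σ) * y)) * ∫ x : ℝ, ‖u x‖ ^ 2) atTop
      (𝓝 0) := by
    have h0 : 0 < lam - 2 * σ := by linarith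
    have := (Real.tendsto_exp_atBot.comp (tendsto_neg_atTop_atBot.comp
      (tendsto_id.const_mul_atTop h0))).mul_const (∫ x : ℝ, ‖u x‖ ^ 2)
    simpa using this
  have := ge_of_tendsto hlim2 (by
    filter_upwards [eventually_ge_atTop 0] with y hy
    exact hb y hy)
  exact norm_le_zero_iff.1 this

/-- The Fourier transform of `|u|²` vanishes outside `[-2σ, 2σ]`. -/
theorem integral_norm_sq_mul_cexp_eq_zero (hu : HasExpGrowth σ u) (hσ : 0 ≤ σ)
    (hi : Integrable fun x : ℝ => ‖u x‖ ^ 2) {lam : ℝ} (hl : 2 * σ < |lam|) :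
    ∫ x : ℝ, ((‖u x‖ ^ 2 : ℝ) : ℂ) * Complex.exp (Complex.I * lam * x) = 0 := by
  rcases le_total 0 lam with h | h
  · rw [abs_of_nonneg h] at hl
    exact hu.integral_norm_sq_mul_cexp_eq_zero_of_lt hσ hi hl
  · rw [abs_of_nonpos h] at hl
    have := hu.integral_norm_sq_mul_cexp_eq_zero_of_lt hσ hi hl
    rw [← map_eq_zero (starRingEnd ℂ), ← integral_conj, ← this]
    congr 1
    ext x
    simp [← Complex.exp_conj]

end HasExpGrowth

/-! ### Testing against powers of the sine; the sharp uncertainty inequality -/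

/-- The coefficients stay anonymous: only the frequencies matter, since the constant coefficient `d
N` appears both in the integral over the line and in the mean over a period, and is eliminated
between them. -/
theorem exists_sin_pow_eq_sum_cexp (N : ℕ) : ∃ d : ℕ → ℂ, ∀ θ : ℝ,
    ((Real.sin θ ^ (2 * N) : ℝ) : ℂ) = ∑ j ∈ Finset.range (2 * N + 1),
      d j * Complex.exp (Complex.I * ((2 * ((N : ℝ) - j) : ℝ) : ℂ) * θ) := by
  refine ⟨fun j => (Complex.I / 2) ^ (2 * N) * ((-1) ^ (2 * N - j) * (2 * N).choose j), fun θ => ?_⟩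
  rw [Complex.ofReal_pow, Complex.ofReal_sin, Complex.sin, mul_div_assoc, mul_pow, mul_comm,
    sub_eq_add_neg, add_pow, Finset.mul_sum]
  refine Finset.sum_congr rfl fun j hj => ?_
  have hj' : j ≤ 2 * N := Nat.lt_succ_iff.1 (Finset.mem_range.1 hj)
  have h2 : (-Complex.exp (θ * Complex.I)) ^ (2 * N - j) =
      (-1) ^ (2 * N - j) * Complex.exp (((2 * N : ℝ) - j : ℝ) * (θ * Complex.I)) := by
    rw [neg_pow, ← Complex.exp_nat_mul, Nat.cast_sub hj']
    push_cast
    rfl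
  rw [h2, ← Complex.exp_nat_mul]
  have h3 : Complex.exp (Complex.I * ((2 * ((N : ℝ) - j) : ℝ) : ℂ) * θ) =
      Complex.exp (j * (-θ * Complex.I)) *
        Complex.exp (((2 * N : ℝ) - j : ℝ) * (θ * Complex.I)) := by
    rw [← Complex.exp_add]
    congr 1
    push_cast
    ring
  rw [h3]
  ring

theorem intervalIntegral_cexp_eq_zero {L : ℝ} (hL : 0 < L) {k : ℤ} (hk : k ≠ 0) :
    ∫ x in (-(Real.pi / (2 * L)))..(Real.pi / (2 * L)),
      Complex.exp (Complex.I * ((2 * k : ℝ) : ℂ) * (L * x : ℝ)) = 0 := by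
  have hc : Complex.I * ((2 * k : ℝ) : ℂ) * L ≠ 0 := by
    simp [hk, hL.ne']
  have h1 : ∀ x : ℝ, Complex.exp (Complex.I * ((2 * k : ℝ) : ℂ) * (L * x : ℝ)) =
      Complex.exp (Complex.I * ((2 * k : ℝ) : ℂ) * L * x) := fun x => by
    rw [Complex.ofReal_mul L x, ← mul_assoc]
  simp only [h1]
  rw [integral_exp_mul_complex hc, div_eq_zero_iff]
  left
  rw [sub_eq_zero, Complex.exp_eq_exp_iff_exists_int]
  refine ⟨k, ?_⟩
  have : (L : ℂ) ≠ 0 := by exact_mod_cast hL.ne'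
  push_cast
  field_simp
  ring

theorem intervalIntegral_neg_eq {p : ℝ → ℝ} (hp : Continuous p) (a : ℝ) :
    ∫ x in (-a)..a, p x = ∫ x in (0 : ℝ)..a, (p x + p (-x)) := by
  rw [← intervalIntegral.integral_add_adjacent_intervals (b := 0) (hp.intervalIntegrable _ _)
    (hp.intervalIntegrable _ _), intervalIntegral.integral_add (hp.intervalIntegrable _ _)
    (Continuous.intervalIntegrable (by fun_prop) _ _), intervalIntegral.integral_comp_neg, neg_zero,
    add_comm]

namespace HasExpGrowth

variable {σ ρ : ℝ} {u v : ℂ → ℂ}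

/-- `|u|²` cannot be distinguished from a constant by trigonometric polynomials of frequencies
`2kL` with `L` larger than the type of `u`. -/
theorem integral_norm_sq_mul_sin_pow (hu : HasExpGrowth σ u) (hσ : 0 ≤ σ)
    (hi : Integrable fun x : ℝ => ‖u x‖ ^ 2) {L : ℝ} (hL : σ < L) (N : ℕ) :
    ∫ x : ℝ, ‖u x‖ ^ 2 * Real.sin (L * x) ^ (2 * N) =
      (∫ x in (-(Real.pi / (2 * L)))..(Real.pi / (2 * L)), Real.sin (L * x) ^ (2 * N)) *
        (L / Real.pi) * ∫ x : ℝ, ‖u x‖ ^ 2 := by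
  have hL0 : 0 < L := hσ.trans_lt hL
  have hcu := hu.continuous
  obtain ⟨d, hd⟩ := exists_sin_pow_eq_sum_cexp N
  have hN : N ∈ Finset.range (2 * N + 1) := Finset.mem_range.2 (by omega)
  have hline : ((∫ x : ℝ, ‖u x‖ ^ 2 * Real.sin (L * x) ^ (2 * N) : ℝ) : ℂ) =
      d N * ((∫ x : ℝ, ‖u x‖ ^ 2 : ℝ) : ℂ) := by
    rw [← integral_complex_ofReal]
    simp only [Complex.ofReal_mul ((‖u _‖) ^ 2), hd, Finset.mul_sum]
    rw [integral_finsetSum]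
    · rw [Finset.sum_eq_single_of_mem N hN]
      · rw [← integral_complex_ofReal, ← integral_const_mul]
        congr 1
        ext x
        simp
        ring
      · intro j _ hj
        have h1 : ∀ x : ℝ, ((‖u x‖ ^ 2 : ℝ) : ℂ) *
            (d j * Complex.exp (Complex.I * ((2 * ((N : ℝ) - j) : ℝ) : ℂ) * (L * x : ℝ))) =
            d j * (((‖u x‖ ^ 2 : ℝ) : ℂ) *
              Complex.exp (Complex.I * ((2 * ((N : ℝ) - j) * L : ℝ) : ℂ) * x)) := by
          intro x
          push_cast
          ring_nf
        simp only [h1]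
        rw [integral_const_mul, hu.integral_norm_sq_mul_cexp_eq_zero hσ hi, mul_zero]
        -- For j ≠ N the frequency 2(N - j)L has modulus at least 2L > 2σ, outside the band of |u|².
        have h2 : (1 : ℝ) ≤ |(N : ℝ) - j| := by
          have : ((N : ℤ) - j) ≠ 0 := by omega
          exact_mod_cast Int.one_le_abs this
        rw [abs_mul, abs_mul, abs_of_pos hL0, abs_two]
        nlinarith
    · intro j _
      refine (hi.mul_const ‖d j‖).mono' (Continuous.aestronglyMeasurable (by fun_prop))
        (Eventually.of_forall fun x => ?_)
      have e1 : (Complex.I * ((2 * ((N : ℝ) - j) : ℝ) : ℂ) * (L * x : ℝ)).re = 0 := by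
        rw [mul_assoc, ← Complex.ofReal_mul, Complex.I_mul_re, Complex.ofReal_im, neg_zero]
      rw [norm_mul, norm_mul, Complex.norm_exp, e1, Real.exp_zero, mul_one, Complex.norm_real,
        Real.norm_eq_abs, abs_of_nonneg (by positivity)]
  have hint : ((∫ x in (-(Real.pi / (2 * L)))..(Real.pi / (2 * L)),
      Real.sin (L * x) ^ (2 * N) : ℝ) : ℂ) = d N * ((Real.pi / L : ℝ) : ℂ) := by
    rw [← intervalIntegral.integral_ofReal]
    simp only [hd]
    rw [intervalIntegral.integral_finsetSum]
    · rw [Finset.sum_eq_single_of_mem N hN]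
      · simp
        field_simp
        ring
      · intro j _ hj
        rw [intervalIntegral.integral_const_mul]
        have := intervalIntegral_cexp_eq_zero hL0 (k := (N : ℤ) - j) (by omega)
        push_cast at this ⊢
        rw [this, mul_zero]
    · intro j _
      exact Continuous.intervalIntegrable (by fun_prop) _ _
  apply Complex.ofReal_injective
  rw [hline, Complex.ofReal_mul, Complex.ofReal_mul, hint]
  have h1 : (L : ℂ) ≠ 0 := by exact_mod_cast hL0.ne'
  have h2 : (Real.pi : ℂ) ≠ 0 := by exact_mod_cast Real.pi_ne_zero
  push_cast
  field_simp

/-- The sharp uncertainty inequality with a strict loss in the type. -/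
theorem mul_integral_norm_sq_le (hu : HasExpGrowth σ u) (hσ : 0 ≤ σ)
    (hi : Integrable fun x : ℝ => ‖u x‖ ^ 2) (hi' : Integrable fun x : ℝ => ‖x * u x‖ ^ 2)
    {L : ℝ} (hL : σ < L) :
    (Real.pi / (2 * L)) ^ 2 * ∫ x : ℝ, ‖u x‖ ^ 2 ≤ ∫ x : ℝ, ‖x * u x‖ ^ 2 := by
  have hL0 : 0 < L := hσ.trans_lt hL
  have hcu := hu.continuous
  -- Multiplication by z costs an arbitrarily small amount of type, so x·u is handled with a type r
  -- strictly between σ and L.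
  obtain ⟨r, hr1, hr2⟩ := exists_between hL
  have hr0 : 0 ≤ r := hσ.trans hr1.le
  set a : ℝ := Real.pi / (2 * L) with ha
  have ha0 : 0 < a := by positivity
  have hLa : L * a = Real.pi / 2 := by rw [ha]; field_simp
  set p : ℝ → ℝ := fun x => ‖u x‖ ^ 2 with hp
  have hpc : Continuous p := by fun_prop
  have hp0 : ∀ x, 0 ≤ p x := fun x => by positivity
  have hq : ∀ x : ℝ, ‖x * u x‖ ^ 2 = x ^ 2 * p x := fun x => by
    rw [norm_mul, mul_pow, Complex.norm_real, Real.norm_eq_abs, sq_abs]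
  have hi'' : Integrable fun x : ℝ => x ^ 2 * p x := by simpa only [hq] using hi'
  set c : ℝ → ℝ := fun x => Real.sin (L * x) ^ 2 with hc
  have hcc : Continuous c := by fun_prop
  have hc0 : ∀ x, 0 ≤ c x := fun x => by positivity
  have hc1 : ∀ x, c x ≤ 1 := fun x => by
    have := Real.sin_sq_le_one (L * x)
    exact this
  have hcneg : ∀ x, c (-x) = c x := fun x => by simp [hc]
  -- On [-a, a] the weight sin² peaks at both endpoints; folding onto [0, a] leaves the single
  -- maximum at a that the concentration theorem requires.
  set g : ℝ → ℝ := fun x => (a ^ 2 - x ^ 2) * (p x + p (-x)) with hg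
  have hgc : Continuous g := by fun_prop
  have hlt : ∀ y ∈ Set.Icc 0 a, y ≠ a → c y < c a := by
    intro y hy hya
    have h1 : c a = 1 := by simp [hc, hLa]
    have h2 : 0 < Real.cos (L * y) := by
      apply Real.cos_pos_of_mem_Ioo
      have : y < a := lt_of_le_of_ne hy.2 hya
      constructor
      · have : 0 ≤ L * y := mul_nonneg hL0.le hy.1
        linarith [Real.pi_pos]
      · rw [← hLa]
        gcongr
    rw [h1]
    have := Real.sin_sq_add_cos_sq (L * y)
    simp only [hc]
    nlinarith
  -- The normalized powers of `c` concentrate at a, so the averages of `g` tend to g(a) = 0.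
  have hpeak := tendsto_setIntegral_pow_smul_of_unique_maximum_of_isCompact_of_continuousOn
    (μ := volume) (isCompact_Icc (a := (0 : ℝ)) (b := a)) hcc.continuousOn hlt (fun x _ => hc0 x)
    (by simp [hc, hLa]) (by rw [interior_Icc, closure_Ioo ha0.ne]; exact ⟨ha0.le, le_rfl⟩)
    hgc.continuousOn
  have hga : g a = 0 := by simp [hg]
  rw [hga] at hpeak
  suffices h : ∀ N : ℕ, -(a * ((∫ x in Set.Icc 0 a, c x ^ N)⁻¹ • ∫ x in Set.Icc 0 a, c x ^ N • g x)) ≤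
      (∫ x : ℝ, x ^ 2 * p x) - a ^ 2 * ∫ x : ℝ, p x by
    have h2 := le_of_tendsto' (hpeak.const_mul a).neg h
    simp only [hq]
    simpa using h2
  intro N
  set b : ℝ := ∫ x in Set.Icc 0 a, c x ^ N with hb
  have hb0 : 0 < b := by
    rw [hb, integral_Icc_eq_integral_Ioc, ← intervalIntegral.integral_of_le ha0.le]
    refine intervalIntegral.intervalIntegral_pos_of_pos_on
      (Continuous.intervalIntegrable (by fun_prop) _ _) (fun x hx => ?_) ha0
    have : 0 < Real.sin (L * x) := by
      apply Real.sin_pos_of_pos_of_lt_pi (mul_pos hL0 hx.1)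
      have : L * x < L * a := by
        have := hx.2
        gcongr
      linarith [Real.pi_pos]
    positivity
  have hcN : ∀ x, Real.sin (L * x) ^ (2 * N) = c x ^ N := fun x => by rw [hc, pow_mul]
  have hbN : (∫ x in (-a)..a, c x ^ N) = 2 * b := by
    rw [intervalIntegral_neg_eq (by fun_prop), hb, integral_Icc_eq_integral_Ioc,
      ← intervalIntegral.integral_of_le ha0.le, ← intervalIntegral.integral_const_mul]
    simp only [hcneg]
    congr 1
    ext x
    ring
  have hm1 := hu.integral_norm_sq_mul_sin_pow hσ hi hL N
  have hm2 := (hu.id_mul hr1).integral_norm_sq_mul_sin_pow hr0 hi' hr2 N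
  simp only [hq, hcN] at hm1 hm2
  rw [← ha, hbN] at hm1 hm2
  change ∫ x, p x * c x ^ N = 2 * b * (L / Real.pi) * ∫ x, p x at hm1
  have hbL : 2 * b * (L / Real.pi) = b / a := by
    rw [ha]
    field_simp
  rw [hbL] at hm1 hm2
  have hcp1 : ∀ x, c x ^ N ≤ 1 := fun x => pow_le_one₀ (hc0 x) (hc1 x)
  have hint : ∀ w : ℝ → ℝ, Continuous w → Integrable w → Integrable fun x => w x * c x ^ N := by
    intro w hw hwi
    refine hwi.norm.mono' (Continuous.aestronglyMeasurable (by fun_prop))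
      (Eventually.of_forall fun x => ?_)
    rw [norm_mul, Real.norm_eq_abs (c x ^ N), abs_of_nonneg (pow_nonneg (hc0 x) N)]
    exact mul_le_of_le_one_right (norm_nonneg _) (hcp1 x)
  have hI1 := hint p hpc hi
  have hI2 := hint _ (by fun_prop) hi''
  have hG : Integrable fun x => (x ^ 2 - a ^ 2) * p x * c x ^ N := by
    refine (hI2.sub (hI1.const_mul (a ^ 2))).congr (Eventually.of_forall fun x => ?_)
    simp only [Pi.sub_apply]
    ring
  have hGeq : ∫ x, (x ^ 2 - a ^ 2) * p x * c x ^ N =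
      b / a * ((∫ x : ℝ, x ^ 2 * p x) - a ^ 2 * ∫ x : ℝ, p x) := by
    have h1 : ∫ x, (x ^ 2 - a ^ 2) * p x * c x ^ N =
        (∫ x, x ^ 2 * p x * c x ^ N) - a ^ 2 * ∫ x, p x * c x ^ N := by
      rw [← integral_const_mul, ← integral_sub hI2 (hI1.const_mul _)]
      congr 1
      ext x
      ring
    rw [h1, hm1, hm2]
    ring
  -- Outside [-a, a] the factor x² - a² is nonnegative, so discarding that region only lowers the
  -- integral.
  have hlow : (∫ x in Set.Icc (-a) a, (x ^ 2 - a ^ 2) * p x * c x ^ N) ≤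
      ∫ x, (x ^ 2 - a ^ 2) * p x * c x ^ N := by
    rw [← integral_indicator measurableSet_Icc]
    refine integral_mono (hG.indicator measurableSet_Icc) hG fun x => ?_
    by_cases hx : x ∈ Set.Icc (-a) a
    · simp [Set.indicator_of_mem hx]
    · rw [Set.indicator_of_notMem hx]
      have h1 : a ^ 2 ≤ x ^ 2 := by
        rw [sq_le_sq, abs_of_pos ha0]
        rw [Set.mem_Icc, ← abs_le] at hx
        exact (not_le.1 hx).le
      have h2 := hp0 x
      have h3 := pow_nonneg (hc0 x) N
      have h4 : 0 ≤ x ^ 2 - a ^ 2 := by linarith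
      positivity
  have hneg : (∫ x in Set.Icc (-a) a, (x ^ 2 - a ^ 2) * p x * c x ^ N) =
      -∫ x in Set.Icc 0 a, c x ^ N • g x := by
    rw [integral_Icc_eq_integral_Ioc, ← intervalIntegral.integral_of_le (by linarith),
      integral_Icc_eq_integral_Ioc, ← intervalIntegral.integral_of_le ha0.le,
      intervalIntegral_neg_eq (by fun_prop), ← intervalIntegral.integral_neg]
    congr 1
    ext x
    simp only [hcneg, hg, smul_eq_mul, neg_sq]
    ring
  rw [hneg, hGeq, div_mul_eq_mul_div, le_div_iff₀ ha0] at hlow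
  rw [smul_eq_mul, ← div_eq_inv_mul, ← mul_div_assoc, neg_le, ← sub_nonneg, sub_neg_eq_add]
  have : 0 ≤ (b * ((∫ x : ℝ, x ^ 2 * p x) - a ^ 2 * ∫ x : ℝ, p x) +
      (∫ x in Set.Icc 0 a, c x ^ N • g x) * a) / b := by
    apply div_nonneg _ hb0.le
    linarith
  rw [add_div, mul_div_cancel_left₀ _ hb0.ne'] at this
  rw [mul_comm a, add_comm]
  exact this

end HasExpGrowth

/-! ### Exponential type, and the uncertainty inequality in [0, ∞] -/

theorem hasExpGrowth_of_exponentialType_le {τ σ : ℝ} {f : ℂ → ℂ} (hf : Differentiable ℂ f)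
    (h : exponentialType f ≤ (τ : EReal)) (hσ : τ < σ) (hσ0 : 0 ≤ σ) : HasExpGrowth σ f := by
  have h1 : exponentialType f < (σ : EReal) := h.trans_lt (EReal.coe_lt_coe_iff.2 hσ)
  have h2 := eventually_lt_of_limsup_lt h1
  have h3 : ∀ᶠ z in Bornology.cobounded ℂ, ‖f z‖ ≤ Real.exp (σ * ‖z‖) := by
    filter_upwards [h2, Bornology.eventually_ne_cobounded (0 : ℂ)] with z hz hz0
    have hpos : 0 < ‖z‖ := norm_pos_iff.2 hz0
    rcases eq_or_ne (f z) 0 with h0 | h0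
    · rw [h0, norm_zero]
      positivity
    · rw [← ofReal_norm, ENNReal.log_ofReal_of_pos (norm_pos_iff.2 h0), ← EReal.coe_mul,
        EReal.coe_lt_coe_iff, ← div_eq_inv_mul, div_lt_iff₀ hpos] at hz
      exact ((Real.log_lt_iff_lt_exp (norm_pos_iff.2 h0)).1 hz).le
  obtain ⟨R, -, hR⟩ := (Metric.hasBasis_cobounded_compl_closedBall (0 : ℂ)).eventually_iff.1 h3
  obtain ⟨M, hM⟩ := (isCompact_closedBall (0 : ℂ) R).exists_bound_of_continuousOn
    hf.continuous.continuousOn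
  refine ⟨hf, max 1 M, fun z => ?_⟩
  have he : 1 ≤ Real.exp (σ * ‖z‖) := Real.one_le_exp (by positivity)
  by_cases hz : z ∈ Metric.closedBall (0 : ℂ) R
  · calc ‖f z‖ ≤ max 1 M := (hM z hz).trans (le_max_right _ _)
      _ ≤ _ := le_mul_of_one_le_right (by positivity) he
  · refine (hR hz).trans (le_mul_of_one_le_left (by positivity) (le_max_left _ _))

theorem HasExpGrowth.exponentialType_le {τ : ℝ} {f : ℂ → ℂ} (hf : HasExpGrowth τ f) :
    exponentialType f ≤ (τ : EReal) := by
  obtain ⟨C, hC0, hC⟩ := hf.bound_nonneg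
  refine le_of_forall_gt fun c hc => ?_
  obtain ⟨σ, hσ1, hσ2⟩ := EReal.lt_iff_exists_real_btwn.1 hc
  refine lt_of_le_of_lt ?_ hσ2
  rw [EReal.coe_lt_coe_iff] at hσ1
  refine limsup_le_of_le (h := ?_)
  have hlim : Tendsto (fun z : ℂ => Real.exp ((σ - τ) * ‖z‖)) (Bornology.cobounded ℂ) atTop :=
    Real.tendsto_exp_atTop.comp (tendsto_norm_cobounded_atTop.const_mul_atTop (sub_pos.2 hσ1))
  filter_upwards [hlim.eventually_ge_atTop C, Bornology.eventually_ne_cobounded (0 : ℂ)] with z hz hz0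
  have hpos : 0 < ‖z‖ := norm_pos_iff.2 hz0
  rcases eq_or_ne (f z) 0 with h0 | h0
  · rw [h0, enorm_zero, ENNReal.log_zero, EReal.coe_mul_bot_of_pos (inv_pos.2 hpos)]
    exact bot_le
  · rw [← ofReal_norm, ENNReal.log_ofReal_of_pos (norm_pos_iff.2 h0), ← EReal.coe_mul,
      EReal.coe_le_coe_iff, ← div_eq_inv_mul, div_le_iff₀ hpos,
      Real.log_le_iff_le_exp (norm_pos_iff.2 h0)]
    refine (hC z).trans ?_
    have : σ * ‖z‖ = (σ - τ) * ‖z‖ + τ * ‖z‖ := by ring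
    rw [this, Real.exp_add]
    gcongr

theorem lintegral_enorm_sq_eq_ofReal {w : ℝ → ℂ} (h : Integrable fun x => ‖w x‖ ^ 2) :
    ∫⁻ x, ‖w x‖ₑ ^ 2 = ENNReal.ofReal (∫ x, ‖w x‖ ^ 2) := by
  rw [ofReal_integral_eq_lintegral_ofReal h (Eventually.of_forall fun x => by positivity)]
  refine lintegral_congr fun x => ?_
  rw [ENNReal.ofReal_pow (norm_nonneg _), ofReal_norm]

theorem integrable_norm_sq_of_lintegral {w : ℝ → ℂ} (hw : Continuous w)
    (h : ∫⁻ x, ‖w x‖ₑ ^ 2 ≠ ∞) : Integrable fun x => ‖w x‖ ^ 2 := by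
  refine ⟨Continuous.aestronglyMeasurable (by fun_prop), ?_⟩
  rw [hasFiniteIntegral_iff_enorm]
  refine lt_of_eq_of_lt (lintegral_congr fun x => ?_) (lt_top_iff_ne_top.2 h)
  rw [enorm_pow, enorm_norm]

/-- The sharp uncertainty inequality for functions of exponential type. -/
theorem ofReal_mul_lintegral_le {τ : ℝ} (hτ : 0 < τ) {f : ℂ → ℂ}
    (hf : ∀ σ, τ < σ → HasExpGrowth σ f) (hi : ∫⁻ x : ℝ, ‖f x‖ₑ ^ 2 ≠ ∞) :
    ENNReal.ofReal ((Real.pi / (2 * τ)) ^ 2) * ∫⁻ x : ℝ, ‖f x‖ₑ ^ 2 ≤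
      ∫⁻ x : ℝ, ‖(x : ℂ) * f x‖ₑ ^ 2 := by
  have hfc : Continuous f := (hf (τ + 1) (by linarith)).continuous
  by_cases htop : ∫⁻ x : ℝ, ‖(x : ℂ) * f x‖ₑ ^ 2 = ∞
  · rw [htop]; exact le_top
  have h1 := integrable_norm_sq_of_lintegral (w := fun x : ℝ => f x) (by fun_prop) hi
  have h2 := integrable_norm_sq_of_lintegral (w := fun x : ℝ => (x : ℂ) * f x) (by fun_prop) htop
  rw [lintegral_enorm_sq_eq_ofReal h1, lintegral_enorm_sq_eq_ofReal h2,
    ← ENNReal.ofReal_mul (by positivity)]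
  apply ENNReal.ofReal_le_ofReal
  -- The constant is continuous in L, so the inequality for every L > τ passes to L = τ.
  have hc : ContinuousAt (fun L : ℝ => (Real.pi / (2 * L)) ^ 2 * ∫ x : ℝ, ‖f x‖ ^ 2) τ := by
    have : 2 * τ ≠ 0 := by positivity
    fun_prop (disch := assumption)
  refine le_of_tendsto (hc.tendsto.mono_left (nhdsWithin_le_nhds (s := Set.Ioi τ))) ?_
  filter_upwards [self_mem_nhdsWithin] with L hL
  obtain ⟨σ, hσ1, hσ2⟩ := exists_between (Set.mem_Ioi.1 hL)
  exact (hf σ hσ1).mul_integral_norm_sq_le (hτ.le.trans hσ1.le) h1 h2 hσ2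

theorem ofReal_mul_lintegral_le_sub {τ : ℝ} (hτ : 0 < τ) {f : ℂ → ℂ}
    (hf : ∀ σ, τ < σ → HasExpGrowth σ f) (hi : ∫⁻ x : ℝ, ‖f x‖ₑ ^ 2 ≠ ∞) (α : ℝ) :
    ENNReal.ofReal ((Real.pi / (2 * τ)) ^ 2) * ∫⁻ x : ℝ, ‖f x‖ₑ ^ 2 ≤
      ∫⁻ x : ℝ, ‖((x : ℂ) - α) * f x‖ₑ ^ 2 := by
  have h1 := lintegral_add_right_eq_self (μ := volume) (fun x : ℝ => ‖f x‖ₑ ^ 2) α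
  have h2 := lintegral_add_right_eq_self (μ := volume)
    (fun x : ℝ => ‖((x : ℂ) - α) * f x‖ₑ ^ 2) α
  simp only [Complex.ofReal_add, add_sub_cancel_right] at h1 h2
  have := ofReal_mul_lintegral_le hτ (f := fun z => f (z + α))
    (fun σ hσ => (hf σ hσ).comp_add_const (hτ.le.trans hσ.le) _) (by rwa [h1])
  rwa [h1, h2] at this

/-! ### The extremal function -/

/-- The entire function `sin z / z`. -/
noncomputable def entireSinc : ℂ → ℂ := dslope Complex.sin 0

theorem entireSinc_ofReal (x : ℝ) : entireSinc x = (Real.sinc x : ℂ) := by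
  rcases eq_or_ne x 0 with rfl | hx
  · simp [entireSinc]
  · have : (x : ℂ) ≠ 0 := by exact_mod_cast hx
    rw [entireSinc, dslope_of_ne _ this, Real.sinc_of_ne_zero hx, slope_def_field]
    simp

theorem differentiable_entireSinc : Differentiable ℂ entireSinc := by
  rw [← differentiableOn_univ, entireSinc, Complex.differentiableOn_dslope univ_mem]
  exact Complex.differentiable_sin.differentiableOn

theorem hasExpGrowth_entireSinc : HasExpGrowth 1 entireSinc := by
  obtain ⟨M, hM⟩ := (isCompact_closedBall (0 : ℂ) 1).exists_bound_of_continuousOn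
    differentiable_entireSinc.continuous.continuousOn
  refine ⟨differentiable_entireSinc, max 1 M, fun z => ?_⟩
  rw [one_mul]
  have he : 1 ≤ Real.exp ‖z‖ := Real.one_le_exp (norm_nonneg _)
  by_cases hz : z ∈ Metric.closedBall (0 : ℂ) 1
  · calc ‖entireSinc z‖ ≤ max 1 M := (hM z hz).trans (le_max_right _ _)
      _ ≤ _ := le_mul_of_one_le_right (by positivity) he
  · rw [mem_closedBall_zero_iff, not_le] at hz
    have hz0 : z ≠ 0 := norm_pos_iff.1 (one_pos.trans hz)
    have hsin : ‖Complex.sin z‖ ≤ Real.exp ‖z‖ := by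
      have h1 : ‖Complex.exp (-z * Complex.I)‖ ≤ Real.exp ‖z‖ := by
        simpa using Complex.norm_exp_le_exp_norm (-z * Complex.I)
      have h2 : ‖Complex.exp (z * Complex.I)‖ ≤ Real.exp ‖z‖ := by
        simpa using Complex.norm_exp_le_exp_norm (z * Complex.I)
      have h3 := norm_sub_le (Complex.exp (-z * Complex.I)) (Complex.exp (z * Complex.I))
      rw [Complex.sin, norm_div, norm_mul, Complex.norm_I, Complex.norm_two]
      linarith
    rw [entireSinc, dslope_of_ne _ hz0, slope_def_field, Complex.sin_zero, sub_zero, sub_zero,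
      norm_div]
    calc ‖Complex.sin z‖ / ‖z‖ ≤ ‖Complex.sin z‖ := div_le_self (norm_nonneg _) hz.le
      _ ≤ Real.exp ‖z‖ := hsin
      _ ≤ _ := le_mul_of_one_le_left (by positivity) (le_max_left _ _)

theorem mul_sinc_eq_sin (x : ℝ) : x * Real.sinc x = Real.sin x := by
  rcases eq_or_ne x 0 with rfl | hx
  · simp
  · rw [Real.sinc_of_ne_zero hx, mul_div_cancel₀ _ hx]

theorem abs_mul_abs_sinc_le_one (x : ℝ) : |x| * |Real.sinc x| ≤ 1 := by
  rw [← abs_mul, mul_sinc_eq_sin]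
  exact Real.abs_sin_le_one x

/-- The extremal function, proportional to `cos (τ z) / (z² - (π / 2τ)²)`. -/
noncomputable def extremizer (τ : ℝ) (z : ℂ) : ℂ :=
  entireSinc (τ * (z - (Real.pi / (2 * τ) : ℝ))) + entireSinc (τ * (z + (Real.pi / (2 * τ) : ℝ)))

theorem hasExpGrowth_extremizer {τ : ℝ} (hτ : 0 < τ) : HasExpGrowth τ (extremizer τ) := by
  have h1 := hasExpGrowth_entireSinc.comp_const_mul τ
  rw [one_mul, abs_of_pos hτ] at h1
  have h2 := (h1.comp_add_const hτ.le (-(Real.pi / (2 * τ) : ℝ))).add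
    (h1.comp_add_const hτ.le (Real.pi / (2 * τ) : ℝ))
  simpa only [← sub_eq_add_neg] using! h2

/-- The extremal function on the real line. -/
noncomputable def realExtremizer (τ x : ℝ) : ℝ :=
  Real.sinc (τ * (x - Real.pi / (2 * τ))) + Real.sinc (τ * (x + Real.pi / (2 * τ)))

theorem extremizer_ofReal (τ x : ℝ) : extremizer τ x = (realExtremizer τ x : ℂ) := by
  rw [extremizer, realExtremizer, Complex.ofReal_add, ← entireSinc_ofReal, ← entireSinc_ofReal]
  push_cast
  rfl

theorem continuous_realExtremizer (τ : ℝ) : Continuous (realExtremizer τ) := by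
  unfold realExtremizer
  have := Real.continuous_sinc
  fun_prop

/-- Shifting by a = π/(2τ) shifts the phase by π/2, so both sine numerators become ∓cos(τx) and the
two fractions combine over x² - a². The identity provides both the decay and the case of equality.
-/
theorem sub_mul_realExtremizer {τ : ℝ} (hτ : 0 < τ) (x : ℝ) :
    (x ^ 2 - (Real.pi / (2 * τ)) ^ 2) * realExtremizer τ x =
      -(Real.pi / τ ^ 2) * Real.cos (τ * x) := by
  set a := Real.pi / (2 * τ) with ha
  have hτa : τ * a = Real.pi / 2 := by rw [ha]; field_simp
  have h1 := mul_sinc_eq_sin (τ * (x - a))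
  have h2 := mul_sinc_eq_sin (τ * (x + a))
  have e1 : Real.sin (τ * (x - a)) = -Real.cos (τ * x) := by
    rw [mul_sub, hτa, Real.sin_sub_pi_div_two]
  have e2 : Real.sin (τ * (x + a)) = Real.cos (τ * x) := by
    rw [mul_add, hτa, Real.sin_add_pi_div_two]
  rw [e1] at h1
  rw [e2] at h2
  have h3 : Real.pi / τ ^ 2 = 2 * a / τ := by rw [ha]; field_simp
  rw [h3, realExtremizer, ← ha]
  apply mul_left_cancel₀ hτ.ne'
  have h4 : τ * (-(2 * a / τ) * Real.cos (τ * x)) = -(2 * a) * Real.cos (τ * x) := by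
    rw [← mul_assoc, mul_neg, mul_div_cancel₀ _ hτ.ne']
  rw [h4]
  linear_combination (x + a) * h1 + (x - a) * h2

theorem abs_realExtremizer_le {τ : ℝ} (hτ : 0 < τ) :
    ∃ C : ℝ, ∀ x, |realExtremizer τ x| ≤ C * (1 + x ^ 2)⁻¹ := by
  refine ⟨Real.pi / τ ^ 2 + 2 * (1 + (Real.pi / (2 * τ)) ^ 2), fun x => ?_⟩
  have hpos : 0 < 1 + x ^ 2 := by positivity
  rw [← div_eq_mul_inv, le_div_iff₀ hpos, ← abs_of_pos hpos, ← abs_mul]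
  -- Splits 1 + x² as (x² - a²) + (1 + a²): the first part is a bounded cosine, the second a
  -- constant times a function bounded by 2.
  have h1 : realExtremizer τ x * (1 + x ^ 2) = -(Real.pi / τ ^ 2) * Real.cos (τ * x) +
      realExtremizer τ x * (1 + (Real.pi / (2 * τ)) ^ 2) := by
    rw [← sub_mul_realExtremizer hτ]
    ring
  rw [h1]
  refine (abs_add_le _ _).trans (add_le_add ?_ ?_)
  · rw [abs_mul, abs_neg, abs_of_pos (by positivity)]
    exact mul_le_of_le_one_right (by positivity) (Real.abs_cos_le_one _)
  · rw [abs_mul, abs_of_pos (a := 1 + (Real.pi / (2 * τ)) ^ 2) (by positivity)]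
    gcongr
    refine (abs_add_le _ _).trans ?_
    have h2 := Real.abs_sinc_le_one (τ * (x - Real.pi / (2 * τ)))
    have h3 := Real.abs_sinc_le_one (τ * (x + Real.pi / (2 * τ)))
    linarith

theorem realExtremizer_sq_le {τ : ℝ} (hτ : 0 < τ) :
    ∃ C : ℝ, ∀ x, (1 + x ^ 2) * realExtremizer τ x ^ 2 ≤ C * (1 + x ^ 2)⁻¹ := by
  obtain ⟨C, hC⟩ := abs_realExtremizer_le hτ
  refine ⟨C ^ 2, fun x => ?_⟩
  have h1 : |realExtremizer τ x| ^ 2 ≤ (C * (1 + x ^ 2)⁻¹) ^ 2 :=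
    pow_le_pow_left₀ (abs_nonneg _) (hC x) 2
  rw [sq_abs] at h1
  calc (1 + x ^ 2) * realExtremizer τ x ^ 2 ≤ (1 + x ^ 2) * (C * (1 + x ^ 2)⁻¹) ^ 2 := by gcongr
    _ = _ := by
      have : 0 < 1 + x ^ 2 := by positivity
      field_simp

theorem integrable_realExtremizer_sq {τ : ℝ} (hτ : 0 < τ) :
    Integrable (fun x => realExtremizer τ x ^ 2) ∧
      Integrable (fun x => x ^ 2 * realExtremizer τ x ^ 2) := by
  obtain ⟨C, hC⟩ := realExtremizer_sq_le hτ
  have hc := continuous_realExtremizer τ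
  have hI := integrable_inv_one_add_sq.const_mul C
  constructor
  · refine hI.mono' (by fun_prop) (Eventually.of_forall fun x => ?_)
    rw [Real.norm_eq_abs, abs_of_nonneg (by positivity)]
    refine le_trans ?_ (hC x)
    nlinarith [sq_nonneg x, sq_nonneg (realExtremizer τ x), mul_nonneg (sq_nonneg x) (sq_nonneg (realExtremizer τ x))]
  · refine hI.mono' (by fun_prop) (Eventually.of_forall fun x => ?_)
    rw [Real.norm_eq_abs, abs_of_nonneg (by positivity)]
    refine le_trans ?_ (hC x)
    nlinarith [sq_nonneg (realExtremizer τ x)]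

/-- Handles the boundary terms of a telescoping integral: windows of fixed length about T and -T, on
which `S` is O(1/T). -/
theorem tendsto_intervalIntegral_window {S : ℝ → ℝ} {C a : ℝ} (ha : 0 ≤ a)
    (hS : ∀ x, |x| * |S x| ≤ C) (w : ℝ → ℝ) (hw : ∀ T, |w T| = |T|) :
    Tendsto (fun T : ℝ => ∫ x in (w T - a)..(w T + a), S x) atTop (𝓝 0) := by
  have hlim : Tendsto (fun T : ℝ => C / (T - a) * (2 * a)) atTop (𝓝 0) := by
    have := (tendsto_const_nhds (x := C)).div_atTop
      (tendsto_atTop_add_const_right atTop (-a) tendsto_id)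
    simpa [← sub_eq_add_neg] using this.mul_const (2 * a)
  refine squeeze_zero_norm' ?_ hlim
  filter_upwards [eventually_gt_atTop a] with T hT
  have h0 : |w T + a - (w T - a)| = 2 * a := by
    rw [show w T + a - (w T - a) = 2 * a by ring, abs_of_nonneg (by positivity)]
  rw [← h0]
  refine intervalIntegral.norm_integral_le_of_norm_le_const fun x hx => ?_
  have hx' : |x - w T| ≤ a := by
    rw [Set.uIoc_of_le (by linarith)] at hx
    rw [abs_le]
    exact ⟨by linarith [hx.1], by linarith [hx.2]⟩
  have hT' : T - a ≤ |x| := by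
    have h1 := abs_sub_abs_le_abs_sub (w T) x
    rw [hw, abs_sub_comm, abs_of_nonneg (ha.trans hT.le)] at h1
    linarith
  have hp : 0 < T - a := by linarith
  rw [Real.norm_eq_abs, le_div_iff₀ hp, mul_comm]
  exact (mul_le_mul_of_nonneg_right hT' (abs_nonneg _)).trans (hS x)

/-- The function (x² - a²)f² is a multiple of S(x - a) - S(x + a). Over [-T, T] everything cancels
except two windows of length 2a around ±T, which vanish in the limit. -/
theorem integral_sq_mul_realExtremizer_sq {τ : ℝ} (hτ : 0 < τ) :
    ∫ x, x ^ 2 * realExtremizer τ x ^ 2 =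
      (Real.pi / (2 * τ)) ^ 2 * ∫ x, realExtremizer τ x ^ 2 := by
  obtain ⟨h1, h2⟩ := integrable_realExtremizer_sq hτ
  set a := Real.pi / (2 * τ) with ha
  have ha0 : 0 < a := by positivity
  have hτa : τ * a = Real.pi / 2 := by rw [ha]; field_simp
  set S : ℝ → ℝ := fun x => Real.sin (τ * x) * Real.sinc (τ * x) with hS
  have hSc : Continuous S := by
    have := Real.continuous_sinc
    fun_prop
  have hSb : ∀ x, |x| * |S x| ≤ 1 / τ := by
    intro x
    have h3 := abs_mul_abs_sinc_le_one (τ * x)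
    have h4 := Real.abs_sin_le_one (τ * x)
    rw [abs_mul, abs_of_pos hτ] at h3
    rw [hS, le_div_iff₀ hτ, abs_mul]
    calc |x| * (|Real.sin (τ * x)| * |Real.sinc (τ * x)|) * τ
        = |Real.sin (τ * x)| * (τ * |x| * |Real.sinc (τ * x)|) := by ring
      _ ≤ 1 * 1 := by gcongr
      _ = 1 := one_mul 1
  have hD : ∀ x, x ^ 2 * realExtremizer τ x ^ 2 - a ^ 2 * realExtremizer τ x ^ 2 =
      Real.pi / τ ^ 2 * (S (x - a) - S (x + a)) := by
    intro x
    have h3 := sub_mul_realExtremizer hτ x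
    rw [← ha] at h3
    have e1 : Real.sin (τ * (x - a)) = -Real.cos (τ * x) := by
      rw [mul_sub, hτa, Real.sin_sub_pi_div_two]
    have e2 : Real.sin (τ * (x + a)) = Real.cos (τ * x) := by
      rw [mul_add, hτa, Real.sin_add_pi_div_two]
    simp only [hS, e1, e2]
    calc _ = ((x ^ 2 - a ^ 2) * realExtremizer τ x) * realExtremizer τ x := by ring
      _ = _ := by
        rw [h3, realExtremizer, ← ha]
        ring
  have hint := h2.sub (h1.const_mul (a ^ 2))
  have hlim := intervalIntegral_tendsto_integral hint tendsto_neg_atTop_atBot tendsto_id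
  have hval : ∀ T : ℝ, ∫ x in (-T)..T, (Real.pi / τ ^ 2 * (S (x - a) - S (x + a))) =
      Real.pi / τ ^ 2 * ((∫ x in (-T - a)..(-T + a), S x) - ∫ x in (T - a)..(T + a), S x) := by
    intro T
    rw [intervalIntegral.integral_const_mul, intervalIntegral.integral_sub
      (Continuous.intervalIntegrable (by fun_prop) _ _)
      (Continuous.intervalIntegrable (by fun_prop) _ _),
      intervalIntegral.integral_comp_sub_right, intervalIntegral.integral_comp_add_right,
      intervalIntegral.integral_interval_sub_interval_comm (hSc.intervalIntegrable _ _)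
        (hSc.intervalIntegrable _ _) (hSc.intervalIntegrable _ _)]
  have hlim0 : Tendsto (fun T : ℝ => ∫ x in (-T)..T,
      (Real.pi / τ ^ 2 * (S (x - a) - S (x + a)))) atTop (𝓝 0) := by
    simp only [hval]
    have := ((tendsto_intervalIntegral_window ha0.le hSb (fun T => -T) fun T => abs_neg T).sub
      (tendsto_intervalIntegral_window ha0.le hSb (fun T => T) fun T => rfl)).const_mul
      (Real.pi / τ ^ 2)
    simpa using this
  simp only [← hD] at hlim0
  have h0 := tendsto_nhds_unique hlim hlim0
  rw [integral_sub' h2 (h1.const_mul _), integral_const_mul] at h0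
  linarith

theorem integral_realExtremizer_sq_pos {τ : ℝ} (hτ : 0 < τ) :
    0 < ∫ x, realExtremizer τ x ^ 2 := by
  have hc := continuous_realExtremizer τ
  refine integral_pos_of_integrable_nonneg_nonzero (x := 0) (by fun_prop)
    (integrable_realExtremizer_sq hτ).1 (fun x => by positivity) ?_
  have h := sub_mul_realExtremizer hτ 0
  intro h0
  rw [pow_eq_zero_iff two_ne_zero] at h0
  rw [h0, mul_zero, mul_zero, Real.cos_zero, mul_one] at h
  have : 0 < Real.pi / τ ^ 2 := by positivity
  linarith

theorem norm_extremizer_ofReal (τ x : ℝ) : ‖extremizer τ x‖ ^ 2 = realExtremizer τ x ^ 2 := by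
  rw [extremizer_ofReal, Complex.norm_real, Real.norm_eq_abs, sq_abs]

theorem norm_mul_extremizer_ofReal (τ x : ℝ) :
    ‖(x : ℂ) * extremizer τ x‖ ^ 2 = x ^ 2 * realExtremizer τ x ^ 2 := by
  rw [norm_mul, mul_pow, norm_extremizer_ofReal, Complex.norm_real, Real.norm_eq_abs, sq_abs]

theorem lintegral_extremizer {τ : ℝ} (hτ : 0 < τ) :
    ∫⁻ x : ℝ, ‖extremizer τ x‖ₑ ^ 2 ≠ 0 ∧ ∫⁻ x : ℝ, ‖extremizer τ x‖ₑ ^ 2 ≠ ∞ ∧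
      ∫⁻ x : ℝ, ‖(x : ℂ) * extremizer τ x‖ₑ ^ 2 =
        ENNReal.ofReal ((Real.pi / (2 * τ)) ^ 2) * ∫⁻ x : ℝ, ‖extremizer τ x‖ₑ ^ 2 := by
  obtain ⟨h1, h2⟩ := integrable_realExtremizer_sq hτ
  rw [lintegral_enorm_sq_eq_ofReal (by simpa only [norm_extremizer_ofReal] using h1),
    lintegral_enorm_sq_eq_ofReal (by simpa only [norm_mul_extremizer_ofReal] using h2)]
  simp only [norm_extremizer_ofReal, norm_mul_extremizer_ofReal]
  refine ⟨(ENNReal.ofReal_pos.2 (integral_realExtremizer_sq_pos hτ)).ne', ENNReal.ofReal_ne_top, ?_⟩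
  rw [integral_sq_mul_realExtremizer_sq hτ, ENNReal.ofReal_mul (by positivity)]

/-! ### Sinc estimates and the cutoff -/

theorem one_sub_sq_le_sinc (y : ℝ) : 1 - y ^ 2 ≤ Real.sinc y := by
  wlog hy : 0 ≤ y generalizing y
  · have := this (-y) (by linarith)
    simpa using this
  rcases hy.eq_or_lt with rfl | hy
  · simp
  rw [Real.sinc_of_ne_zero hy.ne', le_div_iff₀ hy]
  have := Real.sin_gt_sub_cube hy
  nlinarith [pow_pos hy 3]

theorem abs_sinc_two_pi_mul_le_of_abs_le {x : ℝ} (hx : |x| ≤ 1 / 2) :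
    |Real.sinc (2 * Real.pi * x)| ≤ 1 - 2 * x ^ 2 := by
  have hpi := Real.pi_pos
  have h1 : Real.sinc (2 * Real.pi * x) = Real.sinc (Real.pi * x) * Real.cos (Real.pi * x) := by
    rcases eq_or_ne x 0 with rfl | h0
    · simp
    · have h2 : Real.pi * x ≠ 0 := mul_ne_zero hpi.ne' h0
      rw [mul_assoc, Real.sinc_of_ne_zero (mul_ne_zero two_ne_zero h2), Real.sinc_of_ne_zero h2,
        Real.sin_two_mul]
      field_simp
  have habs : |Real.pi * x| ≤ Real.pi / 2 := by
    rw [abs_mul, abs_of_pos hpi]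
    nlinarith
  have hcos : 0 ≤ Real.cos (Real.pi * x) :=
    Real.cos_nonneg_of_mem_Icc (by rw [Set.mem_Icc]; exact abs_le.1 habs)
  have h3 : Real.cos (Real.pi * x) ≤ 1 - 2 / Real.pi ^ 2 * (Real.pi * x) ^ 2 :=
    Real.cos_le_one_sub_mul_cos_sq (by linarith)
  have h4 : 2 / Real.pi ^ 2 * (Real.pi * x) ^ 2 = 2 * x ^ 2 := by field_simp
  rw [h1, abs_mul, abs_of_nonneg hcos]
  rw [h4] at h3
  exact (mul_le_of_le_one_left hcos (Real.abs_sinc_le_one _)).trans h3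

theorem abs_sinc_two_pi_mul_le_of_le_abs {x : ℝ} (hx : 1 / 2 ≤ |x|) :
    |Real.sinc (2 * Real.pi * x)| ≤ 1 / 3 := by
  have h := abs_mul_abs_sinc_le_one (2 * Real.pi * x)
  rw [abs_mul (2 * Real.pi), abs_of_pos Real.two_pi_pos] at h
  have h0 := abs_nonneg (Real.sinc (2 * Real.pi * x))
  have : 3 ≤ 2 * Real.pi * |x| := by nlinarith [Real.pi_gt_three]
  nlinarith

/-- Near 0 the smallest admissible weight vanishes quadratically, while the left side vanishes to
fourth order. The constant 6 comes from |x| ≥ 1/2, where the left side is at most 4 and the weight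
at least 2/3. -/
theorem one_sub_sinc_sq_le {ε : ℝ} (hε : 0 < ε) (hε1 : ε ≤ 1) (x : ℝ) :
    (1 - Real.sinc (ε * x)) ^ 2 ≤ 6 * (1 - |Real.sinc (2 * Real.pi * x)|) := by
  have h1 := Real.sinc_le_one (ε * x)
  have h2 := Real.neg_one_le_sinc (ε * x)
  rcases le_total |x| (1 / 2) with hx | hx
  · have h3 := abs_sinc_two_pi_mul_le_of_abs_le hx
    have h4 := one_sub_sq_le_sinc (ε * x)
    have h5 : (ε * x) ^ 2 ≤ x ^ 2 := by
      rw [mul_pow]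
      exact mul_le_of_le_one_left (sq_nonneg x) (pow_le_one₀ hε.le hε1)
    nlinarith [sq_nonneg x]
  · have := abs_sinc_two_pi_mul_le_of_le_abs hx
    nlinarith

theorem tendsto_sinc_mul {c : ℝ} (hc : 0 < c) :
    Tendsto (fun x => Real.sinc (c * x)) (comap (fun x : ℝ => |x|) atTop) (𝓝 0) := by
  have hlim : Tendsto (fun x : ℝ => (c * |x|)⁻¹) (comap (fun x : ℝ => |x|) atTop) (𝓝 0) :=
    tendsto_inv_atTop_zero.comp (tendsto_comap.const_mul_atTop hc)
  refine squeeze_zero_norm' ?_ hlim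
  filter_upwards [tendsto_comap.eventually_gt_atTop (0 : ℝ)] with x hx
  have h := abs_mul_abs_sinc_le_one (c * x)
  rw [abs_mul c, abs_of_pos hc] at h
  rw [Real.norm_eq_abs, ← one_div, le_div_iff₀ (by positivity), mul_comm]
  exact h

/-- The real function used to localize near `α` and away from the origin. -/
noncomputable def cutoff (ε α x : ℝ) : ℝ := Real.sinc (ε * (x - α)) * (1 - Real.sinc (ε * x))

/-- Three regimes. For |x| < R the point α is at distance at least 3/ε, so the factor centred at α
is small enough to beat the constant of `one_sub_sinc_sq_le`. For |x| ≥ R both the weight and the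
factor 1 - sinc(εx) are close to 1. In the second inequality, points with ε(x - α)² ≥ 1 are paid for
by the last term, and closer points have sinc(ε(x - α)) ≥ 1 - ε. -/
theorem eventually_cutoff {ε : ℝ} (hε : 0 < ε) (hε1 : ε ≤ 1) :
    ∀ᶠ α in comap (fun α : ℝ => |α|) atTop, ∀ x W : ℝ,
      1 - |Real.sinc (2 * Real.pi * x)| ≤ W → W ≤ 1 + |Real.sinc (2 * Real.pi * x)| →
      cutoff ε α x ^ 2 ≤ (1 + ε) * W ∧
        (1 - 3 * ε) * W ≤ cutoff ε α x ^ 2 + ε * (x - α) ^ 2 * W := by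
  have hq := (tendsto_sinc_mul Real.two_pi_pos).abs
  rw [abs_zero] at hq
  have hm := (tendsto_sinc_mul hε).const_sub 1
  rw [sub_zero] at hm
  have hu : ∀ᶠ x in comap (fun x : ℝ => |x|) atTop,
      (1 - Real.sinc (ε * x)) ^ 2 < (1 + ε) * (1 - |Real.sinc (2 * Real.pi * x)|) := by
    refine (hm.pow 2).eventually_lt ((hq.const_sub 1).const_mul (1 + ε)) ?_
    linarith
  -- In the limit this reads 1 - 3ε < (1 - ε)², the right side being the loss of the factor centred
  -- at α.
  have hl : ∀ᶠ x in comap (fun x : ℝ => |x|) atTop,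
      (1 - 3 * ε) * (1 + |Real.sinc (2 * Real.pi * x)|) <
        (1 - ε) ^ 2 * (1 - Real.sinc (ε * x)) ^ 2 := by
    refine ((hq.const_add 1).const_mul (1 - 3 * ε)).eventually_lt ((hm.pow 2).const_mul _) ?_
    nlinarith
  obtain ⟨R, -, hR⟩ := ((atTop_basis.comap (fun x : ℝ => |x|)).eventually_iff).1 (hu.and hl)
  filter_upwards [tendsto_comap.eventually_ge_atTop (R + 3 / ε)] with α hα x W hW1 hW2
  have hq1 := Real.abs_sinc_le_one (2 * Real.pi * x)
  have hW0 : 0 ≤ W := by linarith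
  have hφ1 : Real.sinc (ε * (x - α)) ^ 2 ≤ 1 := by
    rw [sq_le_one_iff_abs_le_one]
    exact Real.abs_sinc_le_one _
  have hcut : cutoff ε α x ^ 2 = Real.sinc (ε * (x - α)) ^ 2 * (1 - Real.sinc (ε * x)) ^ 2 :=
    mul_pow _ _ _
  have hfar : 1 ≤ ε * (x - α) ^ 2 → (1 - 3 * ε) * W ≤ cutoff ε α x ^ 2 + ε * (x - α) ^ 2 * W := by
    intro h
    have h1 : 1 * W ≤ ε * (x - α) ^ 2 * W := by gcongr
    have h2 : 0 ≤ ε * W := by positivity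
    nlinarith [sq_nonneg (cutoff ε α x)]
  rcases le_or_gt R |x| with hx | hx
  · obtain ⟨h1, h2⟩ := hR (show x ∈ (fun x : ℝ => |x|) ⁻¹' Set.Ici R from hx)
    constructor
    · rw [hcut]
      calc _ ≤ 1 * (1 - Real.sinc (ε * x)) ^ 2 := by gcongr
        _ ≤ (1 + ε) * (1 - |Real.sinc (2 * Real.pi * x)|) := by linarith
        _ ≤ _ := by gcongr
    · rcases le_or_gt 1 (ε * (x - α) ^ 2) with h | h
      · exact hfar h
      have h3 : 1 - ε ≤ Real.sinc (ε * (x - α)) := by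
        have := one_sub_sq_le_sinc (ε * (x - α))
        have : (ε * (x - α)) ^ 2 ≤ ε := by
          calc (ε * (x - α)) ^ 2 = ε * (ε * (x - α) ^ 2) := by ring
            _ ≤ ε * 1 := by gcongr
            _ = ε := mul_one ε
        linarith
      have h4 : (1 - ε) ^ 2 ≤ Real.sinc (ε * (x - α)) ^ 2 :=
        pow_le_pow_left₀ (by linarith) h3 2
      have h5 : (1 - ε) ^ 2 * (1 - Real.sinc (ε * x)) ^ 2 ≤ cutoff ε α x ^ 2 := by
        rw [hcut]
        gcongr
      have h6 : 0 ≤ ε * (x - α) ^ 2 * W := by positivity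
      rcases le_or_gt 0 (1 - 3 * ε) with h7 | h7
      · have : (1 - 3 * ε) * W ≤ (1 - 3 * ε) * (1 + |Real.sinc (2 * Real.pi * x)|) := by gcongr
        linarith
      · have : (1 - 3 * ε) * W ≤ 0 := mul_nonpos_of_nonpos_of_nonneg h7.le hW0
        nlinarith [sq_nonneg (cutoff ε α x)]
  · have h3 : 3 ≤ ε * |x - α| := by
      have h4 : 3 / ε ≤ |x - α| := by
        have := abs_sub_abs_le_abs_sub α x
        rw [abs_sub_comm] at this
        linarith
      rw [div_le_iff₀ hε] at h4
      linarith
    constructor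
    · have h4 := abs_mul_abs_sinc_le_one (ε * (x - α))
      rw [abs_mul ε, abs_of_pos hε] at h4
      have h5 : |Real.sinc (ε * (x - α))| ≤ 1 / 3 := by
        have := abs_nonneg (Real.sinc (ε * (x - α)))
        nlinarith
      have h6 : Real.sinc (ε * (x - α)) ^ 2 ≤ 1 / 9 := by
        rw [← sq_abs]
        have := pow_le_pow_left₀ (abs_nonneg _) h5 2
        linarith
      have h7 := one_sub_sinc_sq_le hε hε1 x
      rw [hcut]
      -- The squared sinc contributes 1/9, and 6/9 < 1.
      calc _ ≤ 1 / 9 * (6 * (1 - |Real.sinc (2 * Real.pi * x)|)) := by gcongr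
        _ ≤ 1 / 9 * (6 * W) := by gcongr
        _ ≤ _ := by nlinarith
    · apply hfar
      have h4 : 9 ≤ (ε * |x - α|) ^ 2 := by nlinarith
      rw [mul_pow, sq_abs] at h4
      have h5 : ε ^ 2 * (x - α) ^ 2 ≤ ε * (x - α) ^ 2 := by
        have : ε ^ 2 ≤ ε := by nlinarith
        gcongr
      linarith

/-! ### The five densities and the weighted lower bound -/

/-- Every `densityMeasure` is a continuous density plus a multiple of the Dirac mass at `0`. -/
theorem exists_lintegral_densityMeasure (G : SymmetryGroup) :
    ∃ (W : ℝ → ℝ) (c : ℝ≥0∞), Continuous W ∧ c ≠ ∞ ∧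
      (∀ x, 1 - |Real.sinc (2 * Real.pi * x)| ≤ W x) ∧
      (∀ x, W x ≤ 1 + |Real.sinc (2 * Real.pi * x)|) ∧
      ∀ g : ℝ → ℝ≥0∞, Measurable g →
        ∫⁻ x, g x ∂(densityMeasure G) = (∫⁻ x, ENNReal.ofReal (W x) * g x) + c * g 0 := by
  have hsc := Real.continuous_sinc
  have hm : ∀ s : ℝ, Measurable fun x : ℝ =>
      ENNReal.ofReal (1 + s * Real.sinc (2 * Real.pi * x)) := fun s =>
    (Continuous.measurable (by fun_prop)).ennreal_ofReal
  have hd : ∀ s : ℝ, ∀ g : ℝ → ℝ≥0∞, Measurable g →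
      ∫⁻ x, g x ∂(volume.withDensity fun x : ℝ =>
        ENNReal.ofReal (1 + s * Real.sinc (2 * Real.pi * x))) =
      ∫⁻ x, ENNReal.ofReal (1 + s * Real.sinc (2 * Real.pi * x)) * g x := fun s g hg => by
    rw [lintegral_withDensity_eq_lintegral_mul _ (hm s) hg]
    rfl
  -- All five densities are 1 + s·sinc(2πx) with s ∈ {-1, 0, 1}, plus a point mass of size c at 0.
  suffices h : ∃ (s : ℝ) (c : ℝ≥0∞), |s| ≤ 1 ∧ c ≠ ∞ ∧ densityMeasure G =
      (volume.withDensity fun x : ℝ => ENNReal.ofReal (1 + s * Real.sinc (2 * Real.pi * x))) +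
        c • Measure.dirac 0 by
    obtain ⟨s, c, hs, hc, h⟩ := h
    have habs : ∀ x, |s * Real.sinc (2 * Real.pi * x)| ≤ |Real.sinc (2 * Real.pi * x)| := by
      intro x
      rw [abs_mul]
      exact mul_le_of_le_one_left (abs_nonneg _) hs
    refine ⟨fun x => 1 + s * Real.sinc (2 * Real.pi * x), c, by fun_prop, hc, fun x => ?_,
      fun x => ?_, fun g hg => ?_⟩
    · linarith [(abs_le.1 (habs x)).1]
    · linarith [(abs_le.1 (habs x)).2]
    · rw [h, lintegral_add_measure, lintegral_smul_measure, lintegral_dirac' _ hg, hd s g hg,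
        smul_eq_mul]
  cases G
  · exact ⟨0, 0, by simp, by simp, by simp [densityMeasure]⟩
  · exact ⟨-1, 0, by simp, by simp, by simp [densityMeasure, sub_eq_add_neg]⟩
  · exact ⟨0, 1 / 2, by simp, by simp, by simp [densityMeasure]⟩
  · exact ⟨1, 0, by simp, by simp, by simp [densityMeasure]⟩
  · exact ⟨-1, 1, by simp, by simp, by simp [densityMeasure, sub_eq_add_neg]⟩

theorem enorm_sq_eq_ofReal (z : ℂ) : ‖z‖ₑ ^ 2 = ENNReal.ofReal (‖z‖ ^ 2) := by
  rw [ENNReal.ofReal_pow (norm_nonneg _), ofReal_norm]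

theorem lintegral_enorm_sq_ne_top_of_mem {τ : ℝ} {f : ℂ → ℂ} (hf : f ∈ paleyWienerSet τ) :
    ∫⁻ x : ℝ, ‖f x‖ₑ ^ 2 ≠ ∞ := by
  have h2 := hf.2.2
  have := (memLp_two_iff_integrable_sq_norm h2.1).1 h2
  rw [lintegral_enorm_sq_eq_ofReal (w := fun x : ℝ => f x) this]
  exact ENNReal.ofReal_ne_top

/-- The entire function equal to `cutoff ε α` on the real line. -/
noncomputable def entireCutoff (ε α : ℝ) (z : ℂ) : ℂ :=
  entireSinc (ε * (z - α)) * (1 - entireSinc (ε * z))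

theorem entireCutoff_ofReal (ε α x : ℝ) : entireCutoff ε α x = (cutoff ε α x : ℂ) := by
  rw [entireCutoff, cutoff, Complex.ofReal_mul, Complex.ofReal_sub, ← entireSinc_ofReal,
    ← entireSinc_ofReal]
  push_cast
  rfl

theorem hasExpGrowth_entireCutoff {ε : ℝ} (hε : 0 < ε) (α : ℝ) :
    HasExpGrowth (ε + ε) (entireCutoff ε α) := by
  have h1 := hasExpGrowth_entireSinc.comp_const_mul ε
  rw [one_mul, abs_of_pos hε] at h1
  have h2 := (h1.comp_add_const hε.le (-α : ℂ)).mul ((HasExpGrowth.const hε.le 1).add h1.neg)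
  simpa only [← sub_eq_add_neg] using! h2

/-- The uncertainty inequality in a weighted space, for weights dominating and nearly dominated by
the squared cutoff. -/
theorem ofReal_mul_weighted_lintegral_le {τ ε α : ℝ} (hτ : 0 < τ) (hε : 0 < ε) {W : ℝ → ℝ}
    (hW0 : ∀ x, 0 ≤ W x) (hWc : Continuous W)
    (hcut : ∀ x, cutoff ε α x ^ 2 ≤ (1 + ε) * W x ∧
      (1 - 3 * ε) * W x ≤ cutoff ε α x ^ 2 + ε * (x - α) ^ 2 * W x)
    {f : ℂ → ℂ} (hf : ∀ σ, τ < σ → HasExpGrowth σ f) (hi : ∫⁻ x : ℝ, ‖f x‖ₑ ^ 2 ≠ ∞)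
    {B : ℝ} (hB : B = (Real.pi / (2 * (τ + (ε + ε)))) ^ 2) :
    ENNReal.ofReal (B * (1 - 3 * ε)) * ∫⁻ x : ℝ, ENNReal.ofReal (W x) * ‖f x‖ₑ ^ 2 ≤
      ENNReal.ofReal (1 + ε + B * ε) *
        ∫⁻ x : ℝ, ENNReal.ofReal (W x) * ‖((x : ℂ) - α) * f x‖ₑ ^ 2 := by
  have hfc : Continuous f := (hf (τ + 1) (by linarith)).continuous
  have hB0 : 0 ≤ B := hB ▸ sq_nonneg _
  set P : ℂ → ℂ := fun z => f z * entireCutoff ε α z with hP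
  have hPg : ∀ σ, τ + (ε + ε) < σ → HasExpGrowth σ P := by
    intro σ hσ
    have := (hf (σ - (ε + ε)) (by linarith)).mul (hasExpGrowth_entireCutoff hε α)
    simpa using this
  have hPn : ∀ x : ℝ, ‖P x‖ ^ 2 = ‖f x‖ ^ 2 * cutoff ε α x ^ 2 := fun x => by
    rw [hP]
    simp only
    rw [norm_mul, entireCutoff_ofReal, mul_pow, Complex.norm_real, Real.norm_eq_abs, sq_abs]
  have hlin : ∀ (x : ℝ) (v : ℂ), ‖((x : ℂ) - α) * v‖ ^ 2 = (x - α) ^ 2 * ‖v‖ ^ 2 := fun x v => by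
    rw [norm_mul, mul_pow, ← Complex.ofReal_sub, Complex.norm_real, Real.norm_eq_abs, sq_abs]
  have hc4 : ∀ x, cutoff ε α x ^ 2 ≤ 4 := by
    intro x
    have h1 := Real.abs_sinc_le_one (ε * (x - α))
    have h2 := Real.sinc_le_one (ε * x)
    have h3 := Real.neg_one_le_sinc (ε * x)
    have h4 : Real.sinc (ε * (x - α)) ^ 2 ≤ 1 := sq_le_one_iff_abs_le_one _ |>.2 h1
    have h5 : (1 - Real.sinc (ε * x)) ^ 2 ≤ 4 := by nlinarith
    rw [cutoff, mul_pow]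
    calc _ ≤ 1 * (4 : ℝ) := by gcongr
      _ = 4 := one_mul 4
  have hPi : ∫⁻ x : ℝ, ‖P x‖ₑ ^ 2 ≠ ∞ := by
    refine ne_top_of_le_ne_top (ENNReal.mul_ne_top ENNReal.ofReal_ne_top hi : ENNReal.ofReal 4 *
      ∫⁻ x : ℝ, ‖f x‖ₑ ^ 2 ≠ ∞) ?_
    rw [← lintegral_const_mul' _ _ ENNReal.ofReal_ne_top]
    refine lintegral_mono fun x => ?_
    simp only [enorm_sq_eq_ofReal]
    rw [← ENNReal.ofReal_mul (by norm_num), hPn, mul_comm]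
    apply ENNReal.ofReal_le_ofReal
    gcongr
    exact hc4 x
  -- The product with the cutoff has type τ + 2ε and is square integrable without weight, so the
  -- unweighted inequality centred at α applies to it.
  have key := ofReal_mul_lintegral_le_sub (by linarith : 0 < τ + (ε + ε)) hPg hPi α
  rw [← hB] at key
  set N := ∫⁻ x : ℝ, ENNReal.ofReal (W x) * ‖((x : ℂ) - α) * f x‖ₑ ^ 2 with hN
  have hup : ∫⁻ x : ℝ, ‖((x : ℂ) - α) * P x‖ₑ ^ 2 ≤ ENNReal.ofReal (1 + ε) * N := by
    rw [hN, ← lintegral_const_mul' _ _ ENNReal.ofReal_ne_top]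
    refine lintegral_mono fun x => ?_
    simp only [enorm_sq_eq_ofReal]
    rw [← ENNReal.ofReal_mul (hW0 x), ← ENNReal.ofReal_mul (by linarith)]
    apply ENNReal.ofReal_le_ofReal
    rw [hlin, hlin, hPn]
    have h1 := mul_le_mul_of_nonneg_left (hcut x).1
      (by positivity : 0 ≤ (x - α) ^ 2 * ‖f x‖ ^ 2)
    linarith
  have hmeas : Measurable fun x : ℝ => ENNReal.ofReal ε *
      (ENNReal.ofReal (W x) * ‖((x : ℂ) - α) * f x‖ₑ ^ 2) := by
    have := hWc.measurable
    have := hfc.measurable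
    fun_prop
  have hlow : ENNReal.ofReal (1 - 3 * ε) * ∫⁻ x : ℝ, ENNReal.ofReal (W x) * ‖f x‖ₑ ^ 2 ≤
      (∫⁻ x : ℝ, ‖P x‖ₑ ^ 2) + ENNReal.ofReal ε * N := by
    rw [hN, ← lintegral_const_mul' _ _ ENNReal.ofReal_ne_top,
      ← lintegral_const_mul' _ _ ENNReal.ofReal_ne_top,
      ← lintegral_add_right _ hmeas]
    refine lintegral_mono fun x => ?_
    simp only [enorm_sq_eq_ofReal]
    have hWx := hW0 x
    -- The factor 1 - 3ε may be negative, hence the variant `ENNReal.ofReal_mul'`, which only needs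
    -- the other factor nonnegative.
    rw [← ENNReal.ofReal_mul hWx, ← ENNReal.ofReal_mul hWx, ← ENNReal.ofReal_mul hε.le,
      ← ENNReal.ofReal_add (by positivity) (by positivity),
      ← ENNReal.ofReal_mul' (by positivity)]
    apply ENNReal.ofReal_le_ofReal
    rw [hlin, hPn]
    have h1 := mul_le_mul_of_nonneg_left (hcut x).2 (by positivity : 0 ≤ ‖f x‖ ^ 2)
    linarith
  calc _ = ENNReal.ofReal B * (ENNReal.ofReal (1 - 3 * ε) *
        ∫⁻ x : ℝ, ENNReal.ofReal (W x) * ‖f x‖ₑ ^ 2) := by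
        rw [ENNReal.ofReal_mul hB0, mul_assoc]
    _ ≤ ENNReal.ofReal B * ((∫⁻ x : ℝ, ‖P x‖ₑ ^ 2) + ENNReal.ofReal ε * N) := by gcongr
    _ = ENNReal.ofReal B * (∫⁻ x : ℝ, ‖P x‖ₑ ^ 2) + ENNReal.ofReal B * ENNReal.ofReal ε * N := by
        rw [mul_add, mul_assoc]
    _ ≤ ENNReal.ofReal (1 + ε) * N + ENNReal.ofReal B * ENNReal.ofReal ε * N := by
        exact add_le_add (key.trans hup) le_rfl
    _ = _ := by
        rw [← add_mul, ← ENNReal.ofReal_mul hB0, ← ENNReal.ofReal_add (by linarith) (by positivity)]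

theorem eq_zero_of_forall_ofReal {f : ℂ → ℂ} (hf : Differentiable ℂ f) (h : ∀ x : ℝ, f x = 0) :
    f = 0 := by
  have h1 : AnalyticOnNhd ℂ f Set.univ := fun z _ => hf.analyticAt z
  have h2 : AnalyticOnNhd ℂ (0 : ℂ → ℂ) Set.univ := fun z _ => analyticAt_const
  refine h1.eq_of_frequently_eq (z₀ := 0) h2 ?_
  have ht : Tendsto (fun x : ℝ => (x : ℂ)) (𝓝[≠] 0) (𝓝[≠] 0) := by
    refine tendsto_nhdsWithin_iff.2 ⟨?_, ?_⟩
    · exact (Complex.continuous_ofReal.tendsto' 0 0 Complex.ofReal_zero).mono_left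
        nhdsWithin_le_nhds
    · filter_upwards [self_mem_nhdsWithin] with x hx
      simpa using hx
  exact ht.frequently (Eventually.of_forall fun x => by simp [h x]).frequently

/-- The weight can vanish only at the origin, so a zero integral forces `f` to vanish almost
everywhere on the line, then everywhere by continuity and the identity theorem. -/
theorem weighted_lintegral_ne_zero {f : ℂ → ℂ} (hf : Differentiable ℂ f) (hf0 : f ≠ 0) {W : ℝ → ℝ}
    (hWc : Continuous W) (hW : ∀ x, 1 - |Real.sinc (2 * Real.pi * x)| ≤ W x) :
    ∫⁻ x : ℝ, ENNReal.ofReal (W x) * ‖f x‖ₑ ^ 2 ≠ 0 := by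
  have hfc := hf.continuous
  intro h
  have hmeas : Measurable fun x : ℝ => ENNReal.ofReal (W x) * ‖f x‖ₑ ^ 2 := by
    have := hWc.measurable
    have := hfc.measurable
    fun_prop
  rw [lintegral_eq_zero_iff hmeas] at h
  have hpos : ∀ x : ℝ, x ≠ 0 → 0 < W x := by
    intro x hx
    refine lt_of_lt_of_le ?_ (hW x)
    rcases le_total |x| (1 / 2) with h1 | h1
    · have := abs_sinc_two_pi_mul_le_of_abs_le h1
      have : 0 < x ^ 2 := by positivity
      linarith
    · have := abs_sinc_two_pi_mul_le_of_le_abs h1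
      linarith
  have hae : (fun x : ℝ => f x) =ᵐ[volume] fun _ => 0 := by
    filter_upwards [h, Measure.ae_ne volume (0 : ℝ)] with x hx hx0
    have h1 := hpos x hx0
    simpa [not_le.2 h1] using hx
  have heq := (Continuous.ae_eq_iff_eq volume (by fun_prop) continuous_const).1 hae
  exact hf0 (eq_zero_of_forall_ofReal hf fun x => congrFun heq x)

theorem hasExpGrowth_of_mem {τ : ℝ} (hτ : 0 < τ) {f : ℂ → ℂ} (hf : f ∈ paleyWienerSet τ) :
    ∀ σ, τ < σ → HasExpGrowth σ f := fun _ hσ =>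
  hasExpGrowth_of_exponentialType_le hf.1 hf.2.1 hσ (hτ.le.trans hσ.le)

/-- The continuous and atomic parts are compared separately. The first is the weighted inequality
with ε small in terms of K; in the second the ratio at 0 is α² ≥ K. -/
theorem eventually_le_extremalConstant (G : SymmetryGroup) {τ K : ℝ} (hτ : 0 < τ) (hK0 : 0 ≤ K)
    (hK : K < (Real.pi / (2 * τ)) ^ 2) :
    ∀ᶠ α in comap (fun α : ℝ => |α|) atTop, ENNReal.ofReal K ≤ extremalConstant G τ α := by
  obtain ⟨W, c, hWc, hc, hW1, hW2, hint⟩ := exists_lintegral_densityMeasure G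
  have hW0 : ∀ x, 0 ≤ W x := fun x => by
    have := Real.abs_sinc_le_one (2 * Real.pi * x)
    linarith [hW1 x]
  have hWle : ∀ x, W x ≤ 2 := fun x => by
    have := Real.abs_sinc_le_one (2 * Real.pi * x)
    linarith [hW2 x]
  obtain ⟨ε, hε0, hε1, hKε⟩ : ∃ ε : ℝ, 0 < ε ∧ ε ≤ 1 ∧
      K * (1 + ε + (Real.pi / (2 * (τ + (ε + ε)))) ^ 2 * ε) ≤
        (Real.pi / (2 * (τ + (ε + ε)))) ^ 2 * (1 - 3 * ε) := by
    -- At ε = 0 the required inequality is K < (π/(2τ))², and both sides are continuous there.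
    have hne : 2 * (τ + (0 + 0)) ≠ 0 := by positivity
    have h1 : ContinuousAt (fun ε : ℝ => K * (1 + ε + (Real.pi / (2 * (τ + (ε + ε)))) ^ 2 * ε)) 0 := by
      fun_prop (disch := assumption)
    have h2 : ContinuousAt (fun ε : ℝ => (Real.pi / (2 * (τ + (ε + ε)))) ^ 2 * (1 - 3 * ε)) 0 := by
      fun_prop (disch := assumption)
    have h3 := (h1.tendsto.eventually_lt h2.tendsto (by simpa using hK)).filter_mono
      (nhdsWithin_le_nhds (s := Set.Ioi 0))
    obtain ⟨ε, ⟨h4, h5⟩, h6⟩ := ((h3.and self_mem_nhdsWithin).and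
      (nhdsWithin_le_nhds (Iic_mem_nhds one_pos))).exists
    exact ⟨ε, h5, h6, h4.le⟩
  -- From |α| ≥ K and |α| ≥ 1 follows K ≤ α², which the point mass needs.
  filter_upwards [eventually_cutoff hε0 hε1, tendsto_comap.eventually_ge_atTop (max K 1)]
    with α hα hα2
  rw [extremalConstant]
  refine le_iInf₂ fun f hf => ?_
  obtain ⟨hfm, hf0⟩ := hf
  have hfc : Continuous f := hfm.1.continuous
  have hi := lintegral_enorm_sq_ne_top_of_mem hfm
  rw [hint _ (Continuous.measurable (by fun_prop)), hint _ (Continuous.measurable (by fun_prop))]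
  have hD0 := weighted_lintegral_ne_zero hfm.1 hf0 hWc hW1
  have hDt : ∫⁻ x : ℝ, ENNReal.ofReal (W x) * ‖f x‖ₑ ^ 2 ≠ ∞ := by
    refine ne_top_of_le_ne_top (ENNReal.mul_ne_top ENNReal.ofReal_ne_top hi : ENNReal.ofReal 2 *
      ∫⁻ x : ℝ, ‖f x‖ₑ ^ 2 ≠ ∞) ?_
    rw [← lintegral_const_mul' _ _ ENNReal.ofReal_ne_top]
    refine lintegral_mono fun x => ?_
    gcongr
    exact hWle x
  have hct : c * ‖f ((0 : ℝ) : ℂ)‖ₑ ^ 2 ≠ ∞ :=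
    ENNReal.mul_ne_top hc (ENNReal.pow_ne_top enorm_ne_top)
  rw [ENNReal.le_div_iff_mul_le (Or.inl (by simp [hD0])) (Or.inl (ENNReal.add_ne_top.2 ⟨hDt, hct⟩)),
    mul_add]
  refine add_le_add ?_ ?_
  · have hmain := ofReal_mul_weighted_lintegral_le hτ hε0 hW0 hWc
      (fun x => hα x (W x) (hW1 x) (hW2 x)) (hasExpGrowth_of_mem hτ hfm) hi rfl
    have hk : 0 < 1 + ε + (Real.pi / (2 * (τ + (ε + ε)))) ^ 2 * ε := by positivity
    rw [← ENNReal.mul_le_mul_iff_right (ENNReal.ofReal_pos.2 hk).ne' ENNReal.ofReal_ne_top]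
    refine le_trans ?_ hmain
    rw [← mul_assoc, ← ENNReal.ofReal_mul hk.le]
    exact mul_le_mul' (ENNReal.ofReal_le_ofReal (by linarith)) le_rfl
  · rw [mul_left_comm]
    gcongr
    rw [enorm_sq_eq_ofReal, enorm_sq_eq_ofReal, ← ENNReal.ofReal_mul hK0]
    apply ENNReal.ofReal_le_ofReal
    rw [norm_mul, mul_pow, Complex.ofReal_zero, zero_sub, norm_neg, Complex.norm_real,
      Real.norm_eq_abs]
    have h1 : K ≤ |α| := (le_max_left _ _).trans hα2
    have h2 : 1 ≤ |α| := (le_max_right _ _).trans hα2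
    gcongr
    nlinarith

/-! ### The upper bound from translated extremizers -/

theorem extremizer_ne_zero {τ : ℝ} (hτ : 0 < τ) : extremizer τ ≠ 0 := by
  intro h
  exact (lintegral_extremizer hτ).1 (by simp [h])

theorem extremizer_translate_mem_paleyWienerSet {τ : ℝ} (hτ : 0 < τ) (α : ℝ) :
    (fun z => extremizer τ (z - α)) ∈ paleyWienerSet τ := by
  have hg := (hasExpGrowth_extremizer hτ).comp_add_const hτ.le (-α : ℂ)
  simp only [← sub_eq_add_neg] at hg
  have hc := hg.continuous
  refine ⟨hg.differentiable, hg.exponentialType_le, ?_⟩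
  refine (memLp_two_iff_integrable_sq_norm
    (hc.comp Complex.continuous_ofReal).aestronglyMeasurable).2 ?_
  refine ((integrable_realExtremizer_sq hτ).1.comp_sub_right α).congr
    (Eventually.of_forall fun x => ?_)
  simp only [Function.comp_apply]
  rw [← norm_extremizer_ofReal, Complex.ofReal_sub]

/-- The mean of an integrable function against a weight tending to `1`, translated to infinity. -/
theorem tendsto_weighted_lintegral {W : ℝ → ℝ} (hWc : Continuous W)
    (hW1 : ∀ x, 1 - |Real.sinc (2 * Real.pi * x)| ≤ W x)
    (hW2 : ∀ x, W x ≤ 1 + |Real.sinc (2 * Real.pi * x)|) {g : ℝ → ℝ≥0∞} (hg : Measurable g)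
    (hgi : ∫⁻ x, g x ≠ ∞) :
    Tendsto (fun α : ℝ => ∫⁻ x, ENNReal.ofReal (W x) * g (x - α))
      (comap (fun α : ℝ => |α|) atTop) (𝓝 (∫⁻ x, g x)) := by
  have hshift : ∀ α : ℝ, ∫⁻ x, ENNReal.ofReal (W x) * g (x - α) =
      ∫⁻ x, ENNReal.ofReal (W (x + α)) * g x := by
    intro α
    have := lintegral_add_right_eq_self (μ := volume)
      (fun x : ℝ => ENNReal.ofReal (W x) * g (x - α)) α
    simpa using this.symm
  simp only [hshift]
  have hWle : ∀ x, W x ≤ 2 := fun x => by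
    have := Real.abs_sinc_le_one (2 * Real.pi * x)
    linarith [hW2 x]
  refine tendsto_lintegral_filter_of_dominated_convergence (fun x => ENNReal.ofReal 2 * g x)
    (Eventually.of_forall fun α =>
      (Continuous.measurable (by fun_prop)).ennreal_ofReal.mul hg)
    (Eventually.of_forall fun α => Eventually.of_forall fun x => ?_) ?_
    (Filter.Eventually.of_forall fun x => ?_)
  · gcongr
    exact hWle _
  · rw [lintegral_const_mul' _ _ ENNReal.ofReal_ne_top]
    exact ENNReal.mul_ne_top ENNReal.ofReal_ne_top hgi
  · have hq := (tendsto_sinc_mul Real.two_pi_pos).abs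
    rw [abs_zero] at hq
    have hWt : Tendsto W (comap (fun x : ℝ => |x|) atTop) (𝓝 1) := by
      refine tendsto_of_tendsto_of_tendsto_of_le_of_le ?_ ?_ hW1 hW2
      · simpa using hq.const_sub 1
      · simpa using hq.const_add 1
    have hsh : Tendsto (fun α : ℝ => x + α) (comap (fun x : ℝ => |x|) atTop)
        (comap (fun x : ℝ => |x|) atTop) := by
      rw [tendsto_comap_iff]
      refine tendsto_atTop_mono (f := fun α : ℝ => |α| - |x|) (fun α => ?_) ?_
      · have := abs_sub_abs_le_abs_sub α (-x)
        rw [abs_neg, sub_neg_eq_add, add_comm] at this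
        exact this
      · exact tendsto_atTop_add_const_right _ _ tendsto_comap
    have h1 := ENNReal.tendsto_ofReal (hWt.comp hsh)
    rw [ENNReal.ofReal_one] at h1
    have h2 := ENNReal.Tendsto.mul_const (b := g x) h1 (Or.inl one_ne_zero)
    rw [one_mul] at h2
    exact h2

theorem tendsto_enorm_extremizer_sq {τ : ℝ} (hτ : 0 < τ) :
    Tendsto (fun x : ℝ => ‖extremizer τ x‖ₑ ^ 2) (comap (fun x : ℝ => |x|) atTop) (𝓝 0) ∧
    Tendsto (fun x : ℝ => ‖(x : ℂ) * extremizer τ x‖ₑ ^ 2) (comap (fun x : ℝ => |x|) atTop)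
      (𝓝 0) := by
  obtain ⟨C, hC⟩ := realExtremizer_sq_le hτ
  have hlim : Tendsto (fun x : ℝ => ENNReal.ofReal (C * (1 + x ^ 2)⁻¹))
      (comap (fun x : ℝ => |x|) atTop) (𝓝 0) := by
    have h1 : Tendsto (fun x : ℝ => 1 + x ^ 2) (comap (fun x : ℝ => |x|) atTop) atTop := by
      have := ((tendsto_pow_atTop two_ne_zero).comp
        (tendsto_comap (f := fun x : ℝ => |x|) (x := atTop)))
      refine tendsto_atTop_add_const_left _ _ (this.congr fun x => ?_)
      simp
    have h2 := ENNReal.tendsto_ofReal ((tendsto_inv_atTop_zero.comp h1).const_mul C)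
    simpa using h2
  constructor
  · refine tendsto_of_tendsto_of_tendsto_of_le_of_le tendsto_const_nhds hlim
      (fun _ => zero_le) fun x => ?_
    rw [enorm_sq_eq_ofReal, norm_extremizer_ofReal]
    apply ENNReal.ofReal_le_ofReal
    have : 0 ≤ x ^ 2 * realExtremizer τ x ^ 2 := by positivity
    linarith [hC x]
  · refine tendsto_of_tendsto_of_tendsto_of_le_of_le tendsto_const_nhds hlim
      (fun _ => zero_le) fun x => ?_
    rw [enorm_sq_eq_ofReal, norm_mul_extremizer_ofReal]
    apply ENNReal.ofReal_le_ofReal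
    have : 0 ≤ realExtremizer τ x ^ 2 := by positivity
    linarith [hC x]

/-- The extremizer translated by α is a competitor. Its mass escapes to where the density is nearly
1, and its contribution at the atom decays, so its quotient tends to the unweighted minimum. -/
theorem eventually_extremalConstant_lt (G : SymmetryGroup) {τ : ℝ} {K : ℝ≥0∞} (hτ : 0 < τ)
    (hK : ENNReal.ofReal ((Real.pi / (2 * τ)) ^ 2) < K) :
    ∀ᶠ α in comap (fun α : ℝ => |α|) atTop, extremalConstant G τ α < K := by
  obtain ⟨W, c, hWc, hc, hW1, hW2, hint⟩ := exists_lintegral_densityMeasure G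
  have hhc := (hasExpGrowth_extremizer hτ).continuous
  obtain ⟨h0, ht, heq⟩ := lintegral_extremizer hτ
  obtain ⟨hz1, hz2⟩ := tendsto_enorm_extremizer_sq hτ
  have hneg : Tendsto (fun α : ℝ => -α) (comap (fun x : ℝ => |x|) atTop)
      (comap (fun x : ℝ => |x|) atTop) := by
    rw [tendsto_comap_iff]
    refine (tendsto_comap (f := fun x : ℝ => |x|)).congr fun α => ?_
    simp
  have hlim : ∀ g : ℝ → ℝ≥0∞, Continuous g → ∫⁻ x, g x ≠ ∞ →
      Tendsto g (comap (fun x : ℝ => |x|) atTop) (𝓝 0) →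
      Tendsto (fun α : ℝ => ∫⁻ x, g (x - α) ∂(densityMeasure G))
        (comap (fun x : ℝ => |x|) atTop) (𝓝 (∫⁻ x, g x)) := by
    intro g hg hgi hg0
    have h1 := (tendsto_weighted_lintegral hWc hW1 hW2 hg.measurable hgi).add
      (ENNReal.Tendsto.const_mul (a := c) (hg0.comp hneg) (Or.inr hc))
    rw [mul_zero, add_zero] at h1
    refine h1.congr fun α => ?_
    rw [hint _ (Continuous.measurable (by fun_prop)), zero_sub]
    rfl
  have hN := hlim (fun x => ‖(x : ℂ) * extremizer τ x‖ₑ ^ 2) (by fun_prop)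
    (by rw [heq]; exact ENNReal.mul_ne_top ENNReal.ofReal_ne_top ht) hz2
  have hD := hlim (fun x => ‖extremizer τ x‖ₑ ^ 2) (by fun_prop) ht hz1
  have hq := ENNReal.Tendsto.div hN (Or.inr h0) hD (Or.inl ht)
  rw [heq, ENNReal.mul_div_cancel_right h0 ht] at hq
  filter_upwards [hq.eventually_lt_const hK] with α hα
  refine lt_of_le_of_lt ?_ hα
  have hne : (fun z : ℂ => extremizer τ (z - α)) ≠ 0 := by
    intro h
    apply extremizer_ne_zero hτ
    ext z
    simpa using congrFun h (z + α)
  refine (iInf₂_le (fun z => extremizer τ (z - α)) ⟨extremizer_translate_mem_paleyWienerSet hτ α, hne⟩).trans ?_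
  simp

/-! ### The unitary constant and the limit -/

theorem extremalConstant_U_zero {τ : ℝ} (hτ : 0 < τ) :
    extremalConstant SymmetryGroup.U τ 0 = ENNReal.ofReal ((Real.pi / (2 * τ)) ^ 2) := by
  obtain ⟨h0, ht, heq⟩ := lintegral_extremizer hτ
  apply le_antisymm
  · refine (iInf₂_le (extremizer τ) ⟨by simpa using extremizer_translate_mem_paleyWienerSet hτ 0,
      extremizer_ne_zero hτ⟩).trans ?_
    simp only [densityMeasure, Complex.ofReal_zero, sub_zero]
    rw [heq, ENNReal.mul_div_cancel_right h0 ht]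
  · refine le_iInf₂ fun f hf => ?_
    have hi := lintegral_enorm_sq_ne_top_of_mem hf.1
    have hfc := hf.1.1.continuous
    have hne : ∫⁻ x : ℝ, ‖f x‖ₑ ^ 2 ≠ 0 := by
      have := weighted_lintegral_ne_zero hf.1.1 hf.2 (W := fun _ => 1) continuous_const
        (fun x => by simp)
      simpa using this
    simp only [densityMeasure]
    rw [ENNReal.le_div_iff_mul_le (Or.inl hne) (Or.inl hi)]
    exact ofReal_mul_lintegral_le_sub hτ (hasExpGrowth_of_mem hτ hf.1) hi 0

theorem tendsto_extremalConstant (G : SymmetryGroup) {τ : ℝ} (hτ : 0 < τ) :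
    Tendsto (fun α : ℝ => extremalConstant G τ α) (comap (fun α : ℝ => |α|) atTop)
      (𝓝 (ENNReal.ofReal ((Real.pi / (2 * τ)) ^ 2))) := by
  refine tendsto_order.2 ⟨fun K hK => ?_, fun K hK => eventually_extremalConstant_lt G hτ hK⟩
  obtain ⟨K', hK1, hK2⟩ := exists_between hK
  have hK't : K' ≠ ∞ := (hK2.trans ENNReal.ofReal_lt_top).ne
  rw [ENNReal.lt_ofReal_iff_toReal_lt hK't] at hK2
  filter_upwards [eventually_le_extremalConstant G hτ ENNReal.toReal_nonneg hK2] with α hα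
  rw [ENNReal.ofReal_toReal hK't] at hα
  exact hK1.trans_le hα

theorem theorem3 (G : SymmetryGroup) (Δ : ℝ) (hΔ : 0 < Δ) :
    Tendsto (fun α : ℝ => extremalConstant G (Real.pi * Δ) α)
        (comap (fun α : ℝ => |α|) atTop)
        (𝓝 (extremalConstant SymmetryGroup.U (Real.pi * Δ) 0)) ∧
      extremalConstant SymmetryGroup.U (Real.pi * Δ) 0 = ENNReal.ofReal (1 / (4 * Δ ^ 2)) := by
  have hτ : 0 < Real.pi * Δ := mul_pos Real.pi_pos hΔ
  rw [extremalConstant_U_zero hτ]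
  refine ⟨tendsto_extremalConstant G hτ, ?_⟩
  congr 1
  have := Real.pi_ne_zero
  field_simp
  norm_num
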